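/- All rings are unital, and a Boolean ring is a ring in which $x^2=x$ for every $x$. Let $V$ be an $\mathbb F_2$-vector space. Its associated dual algebra is the graded $\mathbb F_2$-algebra $V_*$ with $V_0=\mathbb F_2$, $V_1=V$ and $V_j=0$ for $j\ge 2$. For a Boolean ring $B$ the associated Boolean graded algebra is the graded $\mathbb F_2$-algebra $B_*$ with $B_0=\mathbb F_2$ and $B_n=B$ for all $n\ge 1$, where for $m,n\ge 1$ the product $B_m\times B_n\to B_{m+n}$ is the multiplication of $B$. The connected sum $C\sqcap D$ of two nonnegatively graded $\mathbb F_2$-algebras with $C_0=D_0=\mathbb F_2$ is the graded algebra with $(C\sqcap D)_0=\mathbb F_2$ and $(C\sqcap D)_i=C_i\oplus D_i$ for $i>0$, in which products of positive degree elements of $C$ with positive degree elements of $D$ are zero. For a commutative graded $\mathbb F_2$-algebra $Q$ and a graded $Q$-module $M$ (viewed as a symmetric $Q$-bimodule), $\mathrm{HH}^{k,s}(Q,M)$ denotes the $k$-th Hochschild cohomology in internal degree $s$, i.e. the $k$-th cohomology group of the complex whose $n$-cochains are the degree-preserving $\mathbb F_2$-linear maps $Q^{\otimes n}\to M[s]$,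 where $M[s]_i=M_{i+s}$, with the Hochschild differential; equivalently, $\mathrm{Ext}^k_{Q\otimes Q}(Q,M[s])$ in the category of graded $Q\otimes Q$-modules. **Theorem.** Let $V$ be an $\mathbb F_2$-vector space, $B$ a Boolean ring and $A\subseteq B$ a finite subring (with the same unit). Regard $V_*\sqcap B_*$ as a graded module over $V_*\sqcap A_*$ through the inclusion. Then $$\mathrm{HH}^{k,2-k}(V_*\sqcap A_*,\,V_*\sqcap B_*)=0\quad\text{for all } k\ge 3.$$ If moreover $|A|\ge 8$ and $s<0$ is an integer, then $$\mathrm{HH}^{k,s}(V_*\sqcap A_*,\,V_*\sqcap B_*)=0\quad\text{for all integers } k\ge 0 \text{ with } k\ne 1-s.$$ -/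

import Mathlib

noncomputable section

/-! ### Graded Hochschild cohomology, through the bar complex -/

section Hochschild

/-- `(a₀, …, aₙ) ↦ (a₀, …, aⱼ aⱼ₊₁, …, aₙ)`. -/
def mergeAt {A : Type*} [CommRing A] {n : ℕ} (j : Fin n) (a : Fin (n + 1) → A) : Fin n → A :=
  fun i => if i < j then a i.castSucc else if i = j then a i.castSucc * a i.succ else a i.succ

theorem mergeAt_update (k : Type*) [CommRing k] {A : Type*} [CommRing A] [Algebra k A]
    {n : ℕ} (j : Fin n) (a : Fin (n + 1) → A) (i : Fin (n + 1)) :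
    ∃ (l : Fin n) (L : A →ₗ[k] A), ∀ x : A,
      mergeAt j (Function.update a i x) = Function.update (mergeAt j a) l (L x) := by
  rcases lt_trichotomy i j.castSucc with h | h | h
  · refine ⟨i.castPred (Fin.ne_last_of_lt h), LinearMap.id, fun x => ?_⟩
    ext m
    simp only [mergeAt, Function.update_apply, Fin.ext_iff, Fin.lt_def, Fin.val_castSucc,
      Fin.val_succ, Fin.coe_castPred, LinearMap.id_apply] at h ⊢
    grind
  · refine ⟨j, LinearMap.mulRight k (a j.succ), fun x => ?_⟩
    ext m
    simp only [mergeAt, Function.update_apply, Fin.ext_iff, Fin.lt_def, Fin.val_castSucc,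
      Fin.val_succ, LinearMap.mulRight_apply] at h ⊢
    grind
  · by_cases h' : i = j.succ
    · refine ⟨j, LinearMap.mulLeft k (a j.castSucc), fun x => ?_⟩
      ext m
      simp only [mergeAt, Function.update_apply, Fin.ext_iff, Fin.lt_def, Fin.val_castSucc,
        Fin.val_succ, LinearMap.mulLeft_apply] at h h' ⊢
      grind
    · have h0 : i ≠ 0 := Fin.ne_zero_of_lt h
      refine ⟨i.pred h0, LinearMap.id, fun x => ?_⟩
      ext m
      simp only [mergeAt, Function.update_apply, Fin.ext_iff, Fin.lt_def, Fin.val_castSucc,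
        Fin.val_succ, Fin.val_pred, LinearMap.id_apply] at h h' h0 ⊢
      grind

variable {k : Type*} [CommRing k] {A : Type*} [CommRing A] [Algebra k A]
  {M : Type*} [AddCommGroup M] [Module k M] [Module A M] [IsScalarTower k A M]

/-- `(a₀, …, aₙ) ↦ a₀ f(a₁, …, aₙ)`. -/
def hochschildFirst {n : ℕ} (f : MultilinearMap k (fun _ : Fin n => A) M) :
    MultilinearMap k (fun _ : Fin (n + 1) => A) M :=
  MultilinearMap.mk' (fun a => a 0 • f (Fin.tail a))
    (by
      intro a i x y
      cases i using Fin.cases with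
      | zero => simp [Fin.tail_update_zero, add_smul]
      | succ i => simp [Fin.tail_update_succ, (Fin.succ_ne_zero i).symm])
    (by
      intro a i c x
      cases i using Fin.cases with
      | zero => simp [Fin.tail_update_zero]
      | succ i =>
        simp [Fin.tail_update_succ, (Fin.succ_ne_zero i).symm, smul_algebra_smul_comm])

/-- `(a₀, …, aₙ) ↦ f(a₀, …, aⱼ aⱼ₊₁, …, aₙ)`. -/
def hochschildMiddle {n : ℕ} (j : Fin n) (f : MultilinearMap k (fun _ : Fin n => A) M) :
    MultilinearMap k (fun _ : Fin (n + 1) => A) M :=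
  MultilinearMap.mk' (fun a => f (mergeAt j a))
    (by
      intro a i x y
      obtain ⟨l, L, h⟩ := mergeAt_update k j a i
      simp [h])
    (by
      intro a i c x
      obtain ⟨l, L, h⟩ := mergeAt_update k j a i
      simp [h])

/-- `(a₀, …, aₙ) ↦ f(a₀, …, aₙ₋₁) aₙ`; the bimodule `M` is symmetric. -/
def hochschildLast {n : ℕ} (f : MultilinearMap k (fun _ : Fin n => A) M) :
    MultilinearMap k (fun _ : Fin (n + 1) => A) M :=
  MultilinearMap.mk' (fun a => a (Fin.last n) • f (Fin.init a))
    (by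
      intro a i x y
      cases i using Fin.lastCases with
      | last => simp [Fin.init_update_last, add_smul]
      | cast i => simp [Fin.init_update_castSucc, (Fin.castSucc_lt_last i).ne'])
    (by
      intro a i c x
      cases i using Fin.lastCases with
      | last => simp [Fin.init_update_last]
      | cast i =>
        simp [Fin.init_update_castSucc, (Fin.castSucc_lt_last i).ne', smul_algebra_smul_comm])

variable (k A M) in
/-- The Hochschild differential from `n`-cochains to `(n+1)`-cochains; `n`-cochains are the
`k`-linear maps `A^{⊗ n} → M`, written as `k`-multilinear maps. -/
def hochschildD (n : ℕ) :
    MultilinearMap k (fun _ : Fin n => A) M →ₗ[k] MultilinearMap k (fun _ : Fin (n + 1) => A) M where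
  toFun f := hochschildFirst f + ∑ j : Fin n, (-1 : k) ^ (j.val + 1) • hochschildMiddle j f
    + (-1 : k) ^ (n + 1) • hochschildLast f
  map_add' f g := by
    ext a
    simp only [hochschildFirst, hochschildMiddle, hochschildLast, add_apply,
      sum_apply, smul_apply, MultilinearMap.mk'_apply, smul_add,
      Finset.sum_add_distrib]
    abel
  map_smul' c f := by
    ext a
    simp only [hochschildFirst, hochschildMiddle, hochschildLast, add_apply,
      sum_apply, smul_apply, MultilinearMap.mk'_apply, smul_add,
      Finset.smul_sum, RingHom.id_apply]
    simp only [← smul_comm c]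

variable (𝒜 : ℕ → Submodule k A) (ℳ : ℤ → Submodule k M)

/-- The Hochschild `n`-cochains of internal degree `s`, i.e. the degree preserving linear maps
`A^{⊗ n} → M[s]`, where `M[s]_i = M_{i+s}`. -/
def hochschildCochains (n : ℕ) (s : ℤ) : Submodule k (MultilinearMap k (fun _ : Fin n => A) M) where
  carrier := {f | ∀ (d : Fin n → ℕ) (a : Fin n → A), (∀ i, a i ∈ 𝒜 (d i)) →
    f a ∈ ℳ (((∑ i, d i : ℕ) : ℤ) + s)}
  add_mem' hf hg d a h := add_mem (hf d a h) (hg d a h)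
  zero_mem' _ _ _ := zero_mem _
  smul_mem' c _ hf d a h := Submodule.smul_mem _ c (hf d a h)

/-- Cocycles of internal degree `s`. -/
def hochschildCocycles (n : ℕ) (s : ℤ) : Submodule k (MultilinearMap k (fun _ : Fin n => A) M) :=
  hochschildCochains 𝒜 ℳ n s ⊓ LinearMap.ker (hochschildD k A M n)

/-- Coboundaries of internal degree `s`. -/
def hochschildCoboundaries (s : ℤ) :
    (n : ℕ) → Submodule k (MultilinearMap k (fun _ : Fin n => A) M)
  | 0 => ⊥
  | n + 1 => (hochschildCochains 𝒜 ℳ n s).map (hochschildD k A M n)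

/-- `HH^{n,s}(A, M)`: cocycles modulo coboundaries. -/
abbrev HH (n : ℕ) (s : ℤ) : Type _ :=
  hochschildCocycles 𝒜 ℳ n s ⧸
    (hochschildCoboundaries 𝒜 ℳ s n).submoduleOf (hochschildCocycles 𝒜 ℳ n s)

end Hochschild

/-! ### Graded algebras with degree zero part `k`, and their connected sum

Such an algebra is `k ⊕ S` for a non-unital algebra `S` graded by the positive integers, that is
`Unitization k S`. -/

section Graded

variable {k : Type*} [CommRing k] {S : Type*} [NonUnitalCommRing S] [Module k S]
  [IsScalarTower k S S] [SMulCommClass k S S]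

/-- The grading of `k ⊕ S`: degree `0` is `k`, degree `n > 0` is `S_n`. -/
def unitGrading (𝒮 : ℕ+ → Submodule k S) : ℕ → Submodule k (Unitization k S)
  | 0 => LinearMap.range (Algebra.linearMap k (Unitization k S))
  | n + 1 => (𝒮 n.succPNat).map (Unitization.inrHom k k S)

/-- A nonnegative grading as a grading by `ℤ`, zero in negative degrees. -/
def intGrading {M : Type*} [AddCommGroup M] [Module k M] (ℳ : ℕ → Submodule k M) :
    ℤ → Submodule k M
  | Int.ofNat n => ℳ n
  | Int.negSucc _ => ⊥

/-- The connected sum `(k ⊕ S) ⊓ (k ⊕ T)`: it is `k` in degree `0` and `S_n ⊕ T_n` in degree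
`n > 0`, and the products of `S` and `T` in it are zero. -/
abbrev ConnectedSum (k S T : Type*) : Type _ := Unitization k (S × T)

/-- The grading of the connected sum. -/
def connectedSumGrading {T : Type*} [NonUnitalCommRing T] [Module k T]
    [IsScalarTower k T T] [SMulCommClass k T T]
    (𝒮 : ℕ+ → Submodule k S) (𝒯 : ℕ+ → Submodule k T) :
    ℕ → Submodule k (ConnectedSum k S T) :=
  unitGrading fun n => (𝒮 n).prod (𝒯 n)

end Graded

/-! ### Dual algebras -/

/-- The positive degree part of the dual algebra `V_*`: the vector space `V` (in degree one), with
zero multiplication. -/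
def DualPos (V : Type*) : Type _ := V

namespace DualPos

variable (V : Type*) [AddCommGroup V] [Module (ZMod 2) V]

instance : AddCommGroup (DualPos V) := inferInstanceAs (AddCommGroup V)

instance : Module (ZMod 2) (DualPos V) := inferInstanceAs (Module (ZMod 2) V)

instance : NonUnitalCommRing (DualPos V) where
  mul _ _ := 0
  left_distrib _ _ _ := (add_zero (0 : DualPos V)).symm
  right_distrib _ _ _ := (add_zero (0 : DualPos V)).symm
  zero_mul _ := rfl
  mul_zero _ := rfl
  mul_assoc _ _ _ := rfl
  mul_comm _ _ := rfl

instance : IsScalarTower (ZMod 2) (DualPos V) (DualPos V) where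
  smul_assoc c _ _ := (smul_zero (A := DualPos V) c).symm

instance : SMulCommClass (ZMod 2) (DualPos V) (DualPos V) where
  smul_comm c _ _ := smul_zero (A := DualPos V) c

/-- `V` is in degree one. -/
def grading (n : ℕ+) : Submodule (ZMod 2) (DualPos V) := if n = 1 then ⊤ else ⊥

end DualPos

/-! ### Boolean graded algebras -/

section Boolean

instance (B : Type*) [BooleanRing B] (A : Subring B) : BooleanRing A where
  isIdempotentElem a := Subtype.ext (BooleanRing.mul_self (a : B))

/-- A Boolean ring is an `𝔽₂`-algebra (in the only possible way). -/
instance (B : Type*) [BooleanRing B] : Algebra (ZMod 2) B :=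
  letI : Module (ZMod 2) B :=
    AddCommGroup.zmodModule fun x => by rw [two_nsmul, BooleanRing.add_self]
  Algebra.ofModule (fun c x y => (ZMod.map_smul (AddMonoidHom.mulRight y) c x).symm ▸ rfl)
    (fun c x y => (ZMod.map_smul (AddMonoidHom.mulLeft x) c y).symm ▸ rfl)

/-- The positive degree part `⨁_{n > 0} B` of the Boolean graded algebra `B_*`: an element is a
finite formal sum of terms `b Xⁿ` with `n > 0`, and `(b Xᵐ) (c Xⁿ) = (b c) X^{m+n}`. -/
abbrev BoolPos (B : Type*) [BooleanRing B] : Type _ := AddMonoidAlgebra B ℕ+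

namespace BoolPos

/-- Degree `n` is the copy `B Xⁿ` of `B`. -/
def grading (B : Type*) [BooleanRing B] (n : ℕ+) : Submodule (ZMod 2) (BoolPos B) where
  carrier := Set.range (AddMonoidAlgebra.single n)
  add_mem' := by
    rintro _ _ ⟨a, rfl⟩ ⟨b, rfl⟩
    exact ⟨a + b, AddMonoidAlgebra.single_add ..⟩
  zero_mem' := ⟨0, AddMonoidAlgebra.single_zero _⟩
  smul_mem' := by
    rintro c _ ⟨a, rfl⟩
    exact ⟨c • a, by simp⟩

/-- The map `A_* → B_*` induced by a ring homomorphism `A → B`, in positive degrees. -/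
def map {A B : Type*} [BooleanRing A] [BooleanRing B] (φ : A →+* B) :
    BoolPos A →ₙₐ[ZMod 2] BoolPos B where
  toFun := AddMonoidAlgebra.map φ.toAddMonoidHom
  map_smul' c x := ZMod.map_smul
    (⟨⟨AddMonoidAlgebra.map φ.toAddMonoidHom, AddMonoidAlgebra.map_zero _⟩,
      AddMonoidAlgebra.map_add _⟩ : BoolPos A →+ BoolPos B) c x
  map_zero' := AddMonoidAlgebra.map_zero _
  map_add' := AddMonoidAlgebra.map_add _
  map_mul' x y := by
    induction x using AddMonoidAlgebra.induction_linear with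
    | zero => simp
    | add x x' hx hx' => simp only [add_mul, AddMonoidAlgebra.map_add, hx, hx']
    | single m a =>
      induction y using AddMonoidAlgebra.induction_linear with
      | zero => simp
      | add y y' hy hy' => simp only [mul_add, AddMonoidAlgebra.map_add, hy, hy']
      | single n b => simp [AddMonoidAlgebra.single_mul_single]

end BoolPos

end Boolean

/-! ### The connected sum `V_* ⊓ B_*` -/

section DualBool

variable (V : Type*) [AddCommGroup V] [Module (ZMod 2) V]

/-- The algebra `V_* ⊓ B_*`. -/
abbrev DualBool (B : Type*) [BooleanRing B] : Type _ :=
  ConnectedSum (ZMod 2) (DualPos V) (BoolPos B)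

/-- The grading of `V_* ⊓ B_*`. -/
def dualBoolGrading (B : Type*) [BooleanRing B] : ℕ → Submodule (ZMod 2) (DualBool V B) :=
  connectedSumGrading (DualPos.grading V) (BoolPos.grading B)

/-- The homomorphism `V_* ⊓ A_* → V_* ⊓ B_*` induced by `A → B`. -/
def DualBool.map {A B : Type*} [BooleanRing A] [BooleanRing B] (φ : A →+* B) :
    DualBool V A →ₐ[ZMod 2] DualBool V B :=
  Unitization.lift ((Unitization.inrNonUnitalAlgHom (ZMod 2) (DualPos V × BoolPos B)).comp
    (NonUnitalAlgHom.prod (NonUnitalAlgHom.fst (ZMod 2) _ _)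
      ((BoolPos.map φ).comp (NonUnitalAlgHom.snd (ZMod 2) _ _))))

variable {B : Type*} [BooleanRing B] (A : Subring B)

/-- For a subring `A ⊆ B`, `V_* ⊓ B_*` is a module over `V_* ⊓ A_*` via the inclusion. -/
instance : Module (DualBool V A) (DualBool V B) :=
  Module.compHom _ (DualBool.map V A.subtype).toRingHom

instance : IsScalarTower (ZMod 2) (DualBool V A) (DualBool V B) where
  smul_assoc c x y := by
    change DualBool.map V A.subtype (c • x) * y = c • (DualBool.map V A.subtype x * y)
    rw [map_smul, smul_mul_assoc]

end DualBool

end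

/-!
Why the theorem holds. The algebra `V_* ⊓ A_*` has a multiplicative basis. A finite Boolean ring
is a product of copies of `𝔽₂` (`BooleanRing.exists_basis`); if `εᵢ` are its primitive idempotents
and `xᵢ = εᵢ X`, the nonzero products of the `xᵢ` and of a basis of `V` are just the powers `xᵢᵐ`.
So Hochschild cochains are functions of words in the monoid `Monomial` of these monomials, and the
differential becomes a recursion on words (`barD`, `hochschildD_apply_eq_barD`). All signs
disappear, since the characteristic is two.

The algebra is quadratic monomial, hence Koszul: its Koszul dual coalgebra is spanned by the words
in the letters `xᵢ`, `v` without two equal consecutive letters `xᵢ xᵢ` (`Monomial.IsKoszul`). That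
restriction to these words is a quasi-isomorphism is proved by an explicit homotopy. After
normalization (`exists_normalized`), the operator `Monomial.split`, which splits `xᵢ` off the
first power `xᵢᵐ`, `m ≥ 2`, that violates the Koszul condition, contracts the functions vanishing
on Koszul words with respect to the differential without its first face
(`Monomial.split_contraction`). The first face drops the first letter and so lowers the degree of
the word; it is a locally nilpotent perturbation, and `Monomial.exists_primitive` is the resulting
perturbed contraction.

It remains to see that the Koszul complex is exact where its values lie in degree `j = k + s`, for
`j < 0`, for `j = 0` if there are three letters `xᵢ`, and for `j ≥ 2` if `k ≥ 2`. In negative degrees there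
is nothing. For `j = 0` the values are scalars, and the cocycle condition on `xᵢ w`, for a letter
`xᵢ` distinct from both ends of `w`, forces the value at `w` to vanish
(`scalar_eq_zero_of_letter`); three letters, that is `|A| ≥ 8`, leave room for such an `xᵢ`. For
`j ≥ 2` the values lie in `B Xʲ = ⨁ᵢ εᵢ B Xʲ`, on whose `i`-th summand only the letter `xᵢ` acts,
as an isomorphism between consecutive degrees; the complex of functions of words with the two
faces that drop `xᵢ` at either end is contracted by prepending `xᵢ`
(`Monomial.exists_koszul_primitive`). For `k ≥ 1`, both parts of the
theorem are instances of `subsingleton_HH_dualBool`.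
-/

noncomputable section

/-! ### The bar differential on functions of words -/

section Bar

variable {Γ : Type*} [MonoidWithZero Γ] {Q : Type*} [CommRing Q]
  {M : Type*} [AddCommGroup M] [Module Q M] (e : Γ →*₀ Q)

/-- Multiplication of the first letter of a word by `a`, as an operator on functions of words. The
empty word is treated as the end of the bar complex, where `a` acts on the coefficients. -/
def absorb (a : Γ) (F : List Γ → M) : List Γ → M
  | [] => e a • F []
  | b :: l => F (a * b :: l)

/-- The Hochschild differential (modulo two) without its first face. -/
def barRight : (List Γ → M) → List Γ → M
  | _, [] => 0
  | F, a :: l => absorb e a F l + barRight (fun t => F (a :: t)) l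

/-- The first face of the Hochschild differential. -/
def barLeft (F : List Γ → M) : List Γ → M
  | [] => 0
  | a :: l => e a • F l

/-- The Hochschild differential modulo two, on functions of words in a multiplicative monoid `Γ`
acting on the coefficients through `e`. -/
def barD (F : List Γ → M) : List Γ → M := fun l => barLeft e F l + barRight e F l

theorem absorb_add (a : Γ) (F G : List Γ → M) :
    absorb e a (F + G) = absorb e a F + absorb e a G := by
  funext l; cases l <;> simp [absorb]

theorem barRight_add (F G : List Γ → M) (l : List Γ) :
    barRight e (F + G) l = barRight e F l + barRight e G l := by
  induction l generalizing F G with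
  | nil => simp [barRight]
  | cons a l ih =>
    have := ih (fun t => F (a :: t)) (fun t => G (a :: t))
    rw [barRight, absorb_add, Pi.add_apply, barRight, barRight, add_add_add_comm, ← this]
    rfl

theorem barRight_smul (q : Q) (F : List Γ → M) (l : List Γ) :
    barRight e (fun t => q • F t) l = q • barRight e F l := by
  induction l generalizing F with
  | nil => simp [barRight]
  | cons a l ih =>
    simp only [barRight, ih (fun t => F (a :: t)), smul_add]
    cases l <;> simp [absorb, smul_comm (e a) q]

theorem barLeft_add (F G : List Γ → M) : barLeft e (F + G) = barLeft e F + barLeft e G := by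
  funext l; cases l <;> simp [barLeft]

theorem barD_add (F G : List Γ → M) : barD e (F + G) = barD e F + barD e G := by
  funext l
  simp only [barD, barLeft_add, barRight_add, Pi.add_apply]
  abel

theorem barRight_zero (l : List Γ) : barRight e (0 : List Γ → M) l = 0 := by
  have h := barRight_add e (0 : List Γ → M) 0 l
  simpa using h

section CharTwo

variable [Module (ZMod 2) M]

theorem barRight_barRight (F : List Γ → M) (l : List Γ) :
    barRight e (barRight e F) l = 0 := by
  have key : ∀ (a : Γ) (F : List Γ → M) (l : List Γ),
      absorb e a (barRight e F) l = barRight e (absorb e a F) l := by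
    intro a F l
    cases l with
    | nil => simp [absorb, barRight]
    | cons b l =>
      have : absorb e (a * b) F l = absorb e b (absorb e a F) l := by
        cases l <;> simp [absorb, mul_assoc, map_mul, mul_smul, smul_comm (e a)]
      rw [barRight, ← this]
      rfl
  induction l generalizing F with
  | nil => rfl
  | cons a l ih =>
    have h : (fun t => barRight e F (a :: t)) =
        absorb e a F + barRight e (fun t => F (a :: t)) := rfl
    rw [barRight, h, barRight_add, ih, key, add_zero, ZModModule.add_self]

theorem barD_barD (F : List Γ → M) : barD e (barD e F) = 0 := by
  funext l
  have h1 : barD e F = barLeft e F + barRight e F := rfl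
  rw [h1, barD_add]
  simp only [Pi.add_apply, barD, barRight_barRight, add_zero, Pi.zero_apply]
  cases l with
  | nil => simp [barLeft, barRight]
  | cons a l =>
    have h2 : (fun t => barLeft e F (a :: t)) = fun t => e a • F t := rfl
    have h3 : absorb e a (barLeft e F) l = e a • barLeft e F l := by
      cases l <;> simp [absorb, barLeft, mul_smul]
    rw [barLeft, barLeft, barRight, h2, h3, barRight_smul, ← add_assoc, ZModModule.add_self,
      zero_add, ZModModule.add_self]

end CharTwo

/-! ### Pointed, normalized and graded cochains -/

/-- A function of words is pointed if it vanishes on words that contain the letter `0`. -/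
def IsPointed (F : List Γ → M) : Prop := ∀ l, 0 ∈ l → F l = 0

variable {e} in
theorem IsPointed.absorb {F : List Γ → M} (hF : IsPointed F) (a : Γ) :
    IsPointed (absorb e a F) := by
  intro l hl
  cases l with
  | nil => simp at hl
  | cons b l =>
    apply hF
    rcases List.mem_cons.1 hl with h | h
    · simp [← h]
    · simp [h]

theorem isPointed_barRight {F : List Γ → M} (hF : IsPointed F) :
    IsPointed (barRight e F) := by
  intro l hl
  induction l generalizing F with
  | nil => rfl
  | cons a l ih =>
    rcases List.mem_cons.1 hl with h | h
    · have h0 : (fun t => F (a :: t)) = 0 := by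
        funext t; exact hF _ (by simp [← h])
      rw [barRight, h0, barRight_zero, add_zero]
      cases l with
      | nil => simp [_root_.absorb, ← h]
      | cons b l => exact hF _ (by simp [← h])
    · rw [barRight, hF.absorb a l h, ih (fun t ht => hF _ (by simp [ht])) h, add_zero]

theorem isPointed_barLeft {F : List Γ → M} (hF : IsPointed F) :
    IsPointed (barLeft e F) := by
  intro l hl
  cases l with
  | nil => rfl
  | cons a l =>
    rcases List.mem_cons.1 hl with h | h
    · simp [barLeft, ← h]
    · simp [barLeft, hF l h]

theorem IsPointed.barD {F : List Γ → M} (hF : IsPointed F) : IsPointed (barD e F) := fun l hl => by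
  rw [_root_.barD, isPointed_barRight e hF l hl, isPointed_barLeft e hF l hl, add_zero]

/-- `F` vanishes on words with the letter `1` among their first `p` letters. -/
def IsNormalizedUpTo (p : ℕ) (F : List Γ → M) : Prop :=
  ∀ u t, u.length < p → F (u ++ 1 :: t) = 0

theorem absorb_one (F : List Γ → M) : absorb e 1 F = F := by
  funext l; cases l <;> simp [absorb]

theorem IsNormalizedUpTo.tail {p : ℕ} {F : List Γ → M} (hF : IsNormalizedUpTo (p + 1) F) (a : Γ) :
    IsNormalizedUpTo p (fun t => F (a :: t)) :=
  fun u t h => hF (a :: u) t (by simpa using h)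

theorem barRight_one_cons {p : ℕ} {F : List Γ → M} (hF : IsNormalizedUpTo (p + 1) F)
    (t : List Γ) : barRight e F (1 :: t) = F t := by
  have h0 : (fun t => F (1 :: t)) = 0 := funext fun t => hF [] t (by simp)
  rw [barRight, h0, barRight_zero, absorb_one, add_zero]

section CharTwo

variable [Module (ZMod 2) M]

theorem barRight_append_one {p : ℕ} {F : List Γ → M} (hF : IsNormalizedUpTo p F) (a : Γ)
    (u t : List Γ) (hu : u.length + 1 < p) : barRight e F (a :: (u ++ 1 :: t)) = 0 := by
  induction u generalizing a p F with
  | nil =>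
    obtain ⟨p, rfl⟩ : ∃ q, p = q + 1 + 1 := ⟨p - 2, by simp at hu; omega⟩
    simp only [List.nil_append]
    rw [barRight, barRight_one_cons e (hF.tail a)]
    simp [absorb, ZModModule.add_self]
  | cons b u ih =>
    obtain ⟨p, rfl⟩ : ∃ q, p = q + 1 := ⟨p - 1, by omega⟩
    rw [barRight, List.cons_append, ih (hF.tail a) b (by simpa using hu), add_zero]
    exact hF (a * b :: u) t (by simp at hu ⊢; omega)

theorem IsNormalizedUpTo.barD {p : ℕ} {F : List Γ → M} (hF : IsNormalizedUpTo p F) :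
    IsNormalizedUpTo p (barD e F) := by
  intro u t hu
  cases u with
  | nil =>
    obtain ⟨p, rfl⟩ : ∃ q, p = q + 1 := ⟨p - 1, by simp at hu; omega⟩
    simp [_root_.barD, barLeft, barRight_one_cons e hF, ZModModule.add_self]
  | cons a u =>
    rw [List.cons_append, _root_.barD, barRight_append_one e hF a u t (by simpa using hu), barLeft,
      hF u t (by simp at hu; omega), smul_zero, add_zero]

end CharTwo

/-- Membership of the value at a word in a subgroup depending on its length and degree. -/
def IsGradedBy (deg : Γ → ℕ) (P : ℕ → ℕ → AddSubgroup M) (F : List Γ → M) : Prop :=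
  ∀ l, F l ∈ P l.length (l.map deg).sum

theorem barRight_mem {deg : Γ → ℕ} (hdeg : ∀ a b, a * b ≠ 0 → deg (a * b) = deg a + deg b)
    {P : ℕ → ℕ → AddSubgroup M} (hP : ∀ a k d m, m ∈ P k d → e a • m ∈ P k (d + deg a))
    {F : List Γ → M} (hF : IsPointed F) (hg : IsGradedBy deg P F) (a : Γ) (l : List Γ) :
    barRight e F (a :: l) ∈ P l.length ((a :: l).map deg).sum := by
  induction l generalizing a F P with
  | nil =>
    have := hP a _ _ _ (hg [])
    simpa [barRight, absorb] using this
  | cons b l ih =>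
    rw [barRight]
    refine add_mem ?_ ?_
    · rw [absorb]
      by_cases h : a * b = 0
      · rw [hF _ (by simp [h])]; exact zero_mem _
      · simpa [hdeg a b h, add_assoc] using hg (a * b :: l)
    · have := ih (P := fun k d => P (k + 1) (d + deg a)) (F := fun t => F (a :: t))
        (fun c k d m hm => by
          have := hP c _ _ _ hm
          rwa [add_right_comm] at this)
        (fun t ht => hF _ (by simp [ht]))
        (fun t => by simpa [add_comm] using hg (a :: t)) b
      simpa [add_comm, add_left_comm] using this

theorem barD_mem {deg : Γ → ℕ} (hdeg : ∀ a b, a * b ≠ 0 → deg (a * b) = deg a + deg b)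
    {P : ℕ → ℕ → AddSubgroup M} (hP : ∀ a k d m, m ∈ P k d → e a • m ∈ P k (d + deg a))
    {F : List Γ → M} (hF : IsPointed F) (hg : IsGradedBy deg P F) (a : Γ) (l : List Γ) :
    barD e F (a :: l) ∈ P l.length ((a :: l).map deg).sum := by
  refine add_mem ?_ (barRight_mem e hdeg hP hF hg a l)
  have := hP a _ _ _ (hg l)
  simpa [barLeft, add_comm] using this

/-- On a word whose consecutive letters have product zero only the last face survives. -/
theorem barRight_append_singleton {F : List Γ → M} (hF : IsPointed F) {l : List Γ} {c : Γ}
    (h : (l ++ [c]).IsChain fun a b => a * b = 0) : barRight e F (l ++ [c]) = e c • F l := by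
  induction l generalizing F with
  | nil => simp [barRight, absorb]
  | cons a l ih =>
    obtain ⟨b, t, ht⟩ : ∃ b t, l ++ [c] = b :: t := by cases l <;> simp
    rw [List.cons_append, ht, List.isChain_cons_cons] at h
    rw [List.cons_append, barRight, ih (fun t ht => hF _ (by simp [ht])) (ht ▸ h.2), ht, absorb,
      h.1, hF _ (by simp), zero_add]

/-! ### Normalization -/

/-- Insertion of the letter `1` at position `p`. -/
def insertOne : ℕ → (List Γ → M) → List Γ → M
  | 0, F, l => F (1 :: l)
  | _ + 1, _, [] => 0
  | p + 1, F, a :: l => insertOne p (fun t => F (a :: t)) l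

theorem insertOne_append (F : List Γ → M) (u t : List Γ) :
    insertOne u.length F (u ++ t) = F (u ++ 1 :: t) := by
  induction u generalizing F with
  | nil => rfl
  | cons a u ih => exact ih _

theorem insertOne_eq_or (p : ℕ) (F : List Γ → M) (l : List Γ) :
    insertOne p F l = 0 ∨ ∃ u t, u.length = p ∧ l = u ++ t ∧ insertOne p F l = F (u ++ 1 :: t) := by
  by_cases h : p ≤ l.length
  · right
    refine ⟨l.take p, l.drop p, by simp [h], by simp, ?_⟩
    have := insertOne_append F (l.take p) (l.drop p)
    simpa [h] using this
  · left
    induction p generalizing F l with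
    | zero => simp at h
    | succ p ih =>
      cases l with
      | nil => rfl
      | cons a l => exact ih _ _ (by simpa using h)

theorem insertOne_succ_append_one (F : List Γ → M) (u t : List Γ) :
    insertOne (u.length + 1) F (u ++ 1 :: t) = insertOne u.length F (u ++ 1 :: t) := by
  have h1 := insertOne_append F u (1 :: t)
  have h2 := insertOne_append F (u ++ [1]) t
  simp only [List.length_append, List.length_singleton, List.append_assoc,
    List.singleton_append] at h2
  rw [h1, h2]

theorem insertOne_add (p : ℕ) (F G : List Γ → M) (l : List Γ) :
    insertOne p (F + G) l = insertOne p F l + insertOne p G l := by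
  induction p generalizing F G l with
  | zero => rfl
  | succ p ih =>
    cases l with
    | nil => simp [insertOne]
    | cons a l => exact ih (fun t => F (a :: t)) (fun t => G (a :: t)) l

theorem insertOne_smul (p : ℕ) (q : Q) (F : List Γ → M) (l : List Γ) :
    insertOne p (fun t => q • F t) l = q • insertOne p F l := by
  induction p generalizing F l with
  | zero => rfl
  | succ p ih =>
    cases l with
    | nil => simp [insertOne]
    | cons a l => exact ih (fun t => F (a :: t)) l

theorem IsNormalizedUpTo.insertOne {p : ℕ} {F : List Γ → M} (hF : IsNormalizedUpTo p F) :
    IsNormalizedUpTo p (insertOne p F) := by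
  intro u t hu
  rcases insertOne_eq_or p F (u ++ 1 :: t) with h | ⟨u', t', h1, h2, h3⟩
  · exact h
  · rw [h3]
    obtain ⟨r, rfl⟩ : ∃ r, u' = u ++ 1 :: r := by
      rcases List.append_eq_append_iff.1 h2 with ⟨r, hr, hr'⟩ | ⟨r, hr, hr'⟩
      · cases r with
        | nil => simp at hr; subst hr; omega
        | cons c r =>
          simp at hr'
          exact ⟨r, by rw [hr, hr'.1]⟩
      · have := congrArg List.length hr
        simp at this; omega
    simpa using hF u (r ++ 1 :: t') hu

section CharTwo

variable [Module (ZMod 2) M]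

theorem barRight_insertOne (F : List Γ → M) (u t : List Γ) :
    barRight e (insertOne u.length F) (u ++ 1 :: t) +
      insertOne u.length (barRight e F) (u ++ 1 :: t) = F (u ++ 1 :: t) := by
  induction u generalizing F with
  | nil =>
    change absorb e 1 (fun t => F (1 :: t)) t + barRight e (fun t => F (1 :: 1 :: t)) t +
      (F (1 * 1 :: t) + (absorb e 1 (fun t => F (1 :: t)) t +
        barRight e (fun t => F (1 :: 1 :: t)) t)) = F (1 :: t)
    rw [absorb_one, mul_one]
    have h2 := ZModModule.add_self (F (1 :: t))
    have h3 := ZModModule.add_self (barRight e (fun t => F (1 :: 1 :: t)) t)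
    linear_combination (norm := module) h2 + h3
  | cons a u ih =>
    have h1 : (fun t => barRight e F (a :: t)) =
        absorb e a F + barRight e (fun t => F (a :: t)) := rfl
    change absorb e a (insertOne (u.length + 1) F) (u ++ 1 :: t) +
      barRight e (insertOne u.length (fun t => F (a :: t))) (u ++ 1 :: t) +
      insertOne u.length (fun t => barRight e F (a :: t)) (u ++ 1 :: t) = F (a :: (u ++ 1 :: t))
    rw [h1, insertOne_add]
    have h2 : absorb e a (insertOne (u.length + 1) F) (u ++ 1 :: t) =
        insertOne u.length (absorb e a F) (u ++ 1 :: t) := by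
      cases u with
      | nil => simp [absorb, insertOne]
      | cons b u =>
        simpa [absorb, insertOne] using
          insertOne_succ_append_one (fun t => F (a * b :: t)) u t
    rw [h2]
    have h3 := ZModModule.add_self (insertOne u.length (absorb e a F) (u ++ 1 :: t))
    have := ih (fun t => F (a :: t))
    linear_combination (norm := module) h3 + this

/-- Inserting `1` at position `p` is a homotopy from zero to the identity on words that already
carry a `1` there. -/
theorem barD_insertOne (F : List Γ → M) (u t : List Γ) :
    barD e (insertOne u.length F) (u ++ 1 :: t) +
      insertOne u.length (barD e F) (u ++ 1 :: t) = F (u ++ 1 :: t) := by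
  have h : barD e F = barLeft e F + barRight e F := rfl
  have h2 : barLeft e (insertOne u.length F) (u ++ 1 :: t) =
      insertOne u.length (barLeft e F) (u ++ 1 :: t) := by
    cases u with
    | nil => simp [insertOne, barLeft]
    | cons a u =>
      simp only [List.length_cons, insertOne, List.cons_append, barLeft,
        insertOne_succ_append_one, insertOne_smul]
  rw [h, insertOne_add, barD, h2]
  have h3 := ZModModule.add_self (insertOne u.length (barLeft e F) (u ++ 1 :: t))
  have := barRight_insertOne e F u t
  linear_combination (norm := module) h3 + this

/-- Every cocycle is cohomologous to a normalized one. -/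
theorem exists_normalized {deg : Γ → ℕ}
    (hdeg : ∀ a b, a * b ≠ 0 → deg (a * b) = deg a + deg b) (hone : deg 1 = 0)
    {P P' : ℕ → ℕ → AddSubgroup M}
    (hP : ∀ a k d m, m ∈ P k d → e a • m ∈ P k (d + deg a))
    (hPP : ∀ k d, P' (k + 1) d = P k d)
    {F : List Γ → M} (hF : IsPointed F) (hg : IsGradedBy deg P' F) (hD : barD e F = 0) (p : ℕ) :
    ∃ h : List Γ → M, IsPointed h ∧ IsGradedBy deg P h ∧ IsNormalizedUpTo p (F + barD e h) := by
  induction p with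
  | zero =>
    exact ⟨0, fun _ _ => rfl, fun _ => zero_mem _, fun u t h => by simp at h⟩
  | succ p ih =>
    obtain ⟨h, hp, hgr, hn⟩ := ih
    set G := F + barD e h with hG
    have hDG : barD e G = 0 := by rw [hG, barD_add, hD, barD_barD, add_zero]
    have hGp : IsPointed G := fun l hl => by
      simp [hG, hF l hl, hp.barD e l hl]
    have hGg : IsGradedBy deg P' G := by
      intro l
      refine add_mem (hg l) ?_
      cases l with
      | nil => simp [barD, barLeft, barRight, zero_mem]
      | cons a l => rw [List.length_cons, hPP]; exact barD_mem e hdeg hP hp hgr a l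
    refine ⟨h + insertOne p G, ?_, ?_, ?_⟩
    · intro l hl
      rcases insertOne_eq_or p G l with h1 | ⟨u, t, -, h2, h3⟩
      · simp [h1, hp l hl]
      · rw [Pi.add_apply, hp l hl, h3, hGp _ (by subst h2; simp at hl ⊢; tauto), add_zero]
    · intro l
      refine add_mem (hgr l) ?_
      rcases insertOne_eq_or p G l with h1 | ⟨u, t, -, h2, h3⟩
      · rw [h1]; exact zero_mem _
      · rw [h3]
        have := hGg (u ++ 1 :: t)
        subst h2
        rw [show (u ++ 1 :: t).length = (u ++ t).length + 1 by simp; omega, hPP] at this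
        simpa [hone] using this
    · rw [barD_add, ← add_assoc, ← hG]
      intro u t hu
      rcases Nat.lt_succ_iff_lt_or_eq.1 hu with hu | rfl
      · rw [Pi.add_apply, hn u t hu, hn.insertOne.barD e u t hu, add_zero]
      · have := barD_insertOne e G u t
        have h0 : insertOne u.length (0 : List Γ → M) (u ++ 1 :: t) = 0 := by
          rw [insertOne_append]; rfl
        rw [hDG, h0, add_zero] at this
        rw [Pi.add_apply, this, ZModModule.add_self]

end CharTwo

end Bar

/-! ### Monomials -/

/-- The multiplicative monoid of monomials `0`, `1`, `v b`, `xᵢ ^ (m + 1)` (written `x i m`) of the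
connected sum of a dual algebra with basis `β` and of polynomial rings `k[xᵢ]`, `i ∈ ι`. -/
inductive Monomial (β ι : Type*)
  | zero : Monomial β ι
  | one : Monomial β ι
  | v : β → Monomial β ι
  | x : ι → ℕ → Monomial β ι

namespace Monomial

variable {β ι : Type*}

instance : Zero (Monomial β ι) := ⟨zero⟩

instance : One (Monomial β ι) := ⟨one⟩

theorem zero_def : (0 : Monomial β ι) = zero := rfl

theorem one_def : (1 : Monomial β ι) = one := rfl

open Classical in
/-- The product of two monomials: the only nonzero products of monomials other than `1` are
`xᵢ ^ (m + 1) * xᵢ ^ (n + 1) = xᵢ ^ (m + n + 2)`. -/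
def mul : Monomial β ι → Monomial β ι → Monomial β ι
  | one, b => b
  | a, one => a
  | x i m, x j n => if i = j then x i (m + n + 1) else zero
  | _, _ => zero

instance : Mul (Monomial β ι) := ⟨mul⟩

theorem x_mul_x_self (i : ι) (m n : ℕ) : (x i m * x i n : Monomial β ι) = x i (m + n + 1) :=
  if_pos rfl

theorem x_mul_x {i j : ι} (h : i ≠ j) (m n : ℕ) : (x i m * x j n : Monomial β ι) = 0 :=
  if_neg h

theorem v_mul_v (b c : β) : (v b * v c : Monomial β ι) = 0 := rfl

theorem v_mul_x (b : β) (i : ι) (m : ℕ) : (v b * x i m : Monomial β ι) = 0 := rfl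

theorem x_mul_v (b : β) (i : ι) (m : ℕ) : (x i m * v b : Monomial β ι) = 0 := rfl

instance : MonoidWithZero (Monomial β ι) where
  one_mul _ := rfl
  mul_one a := by cases a <;> rfl
  zero_mul a := by cases a <;> rfl
  mul_zero a := by cases a <;> rfl
  mul_assoc a b c := by
    rcases a with _ | _ | a | ⟨i, m⟩ <;> rcases b with _ | _ | b | ⟨j, n⟩ <;>
      rcases c with _ | _ | c | ⟨k, p⟩ <;> try rfl
    all_goals
      change mul (mul _ _) _ = mul _ (mul _ _)
      simp only [mul]
      try split_ifs <;> simp_all <;> omega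

/-- The degree of a monomial; the value at zero is irrelevant. -/
def deg : Monomial β ι → ℕ
  | zero => 0
  | one => 0
  | v _ => 1
  | x _ m => m + 1

theorem deg_mul (a b : Monomial β ι) (h : a * b ≠ 0) : deg (a * b) = deg a + deg b := by
  rcases a with _ | _ | a | ⟨i, m⟩ <;> rcases b with _ | _ | b | ⟨j, n⟩ <;>
    try first | exact absurd rfl h | exact (Nat.zero_add _).symm | rfl
  by_cases hij : i = j
  · subst hij
    rw [x_mul_x_self]; simp only [deg]; omega
  · exact absurd (x_mul_x hij m n) h

/-- A word in the degree one monomials without two equal consecutive letters `xᵢ xᵢ`; with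
`st = some i` the word is moreover not allowed to start with `xᵢ`. These words span the Koszul dual
coalgebra. -/
def IsKoszul : Option ι → List (Monomial β ι) → Prop
  | _, [] => True
  | _, v _ :: l => IsKoszul none l
  | st, x i 0 :: l => st ≠ some i ∧ IsKoszul (some i) l
  | _, x _ (_ + 1) :: _ => False
  | _, zero :: _ => False
  | _, one :: _ => False

theorem IsKoszul.of_some {st : Option ι} {l : List (Monomial β ι)} (h : IsKoszul st l) :
    IsKoszul none l := by
  rcases l with _ | ⟨_ | _ | b | ⟨i, _ | m⟩, l⟩ <;> simp_all [IsKoszul]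

theorem IsKoszul.of_append {st : Option ι} {l t : List (Monomial β ι)} (h : IsKoszul st (l ++ t)) :
    IsKoszul st l := by
  induction l generalizing st with
  | nil => trivial
  | cons a l ih => rcases a with _ | _ | b | ⟨i, _ | m⟩ <;> simp_all [IsKoszul]

theorem IsKoszul.isChain {st : Option ι} {l : List (Monomial β ι)} (h : IsKoszul st l) :
    l.IsChain fun a b => a * b = 0 := by
  induction l generalizing st with
  | nil => simp
  | cons a l ih =>
    rcases l with _ | ⟨b, l⟩
    · simp
    rw [List.isChain_cons_cons]
    rcases a with _ | _ | a | ⟨i, _ | m⟩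
    · exact h.elim
    · exact h.elim
    · refine ⟨?_, ih (st := none) h⟩
      rcases b with _ | _ | b | ⟨j, _ | n⟩
      exacts [h.elim, h.elim, v_mul_v _ _, v_mul_x _ _ _, v_mul_x _ _ _]
    · refine ⟨?_, ih h.2⟩
      rcases b with _ | _ | b | ⟨j, _ | n⟩
      exacts [h.2.elim, h.2.elim, x_mul_v _ _ _, x_mul_x (fun hij => h.2.1 (by rw [hij])) _ _,
        h.2.elim]
    · exact h.elim

theorem IsKoszul.deg {st : Option ι} {l : List (Monomial β ι)} (h : IsKoszul st l) :
    (l.map deg).sum = l.length := by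
  induction l generalizing st with
  | nil => rfl
  | cons a l ih =>
    rcases a with _ | _ | b | ⟨i, _ | m⟩
    · exact h.elim
    · exact h.elim
    · simp [Monomial.deg, ih (st := none) h, add_comm]
    · simp [Monomial.deg, ih h.2, add_comm]
    · exact h.elim

theorem IsKoszul.isProper {st : Option ι} {l : List (Monomial β ι)} (h : IsKoszul st l) :
    0 ∉ l ∧ 1 ∉ l := by
  induction l generalizing st with
  | nil => simp
  | cons a l ih =>
    rcases a with _ | _ | b | ⟨i, _ | m⟩
    · exact h.elim
    · exact h.elim
    · simpa [zero_def, one_def] using ih (st := none) h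
    · simpa [zero_def, one_def] using ih h.2
    · exact h.elim

variable {M : Type*} [AddCommGroup M]

open Classical in
/-- The operator on functions of words which is dual to splitting off `xᵢ` from the first letter
`xᵢ ^ (m + 2)` that ends a Koszul prefix. It is zero on words in which the first letter violating
the Koszul condition is a power `xᵢ ^ (m + 1)` preceded by `xᵢ`. The index `st` records the
letter read before the word. -/
def split : Option ι → (List (Monomial β ι) → M) → List (Monomial β ι) → M
  | _, _, [] => 0
  | _, F, v b :: l => split none (fun t => F (v b :: t)) l
  | st, F, x i 0 :: l => if st = some i then 0 else split (some i) (fun t => F (x i 0 :: t)) l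
  | st, F, x i (m + 1) :: l => if st = some i then 0 else F (x i 0 :: x i m :: l)
  | _, _, zero :: _ => 0
  | _, _, one :: _ => 0

/-- The value of `split st F` at a word is zero or a value of `F` at a word with one more letter, of
the same degree and with the same letters `0` and `1`. -/
theorem split_induction (st : Option ι) (F : List (Monomial β ι) → M) (l : List (Monomial β ι))
    (p : M → Prop) (h0 : p 0)
    (h : ∀ t : List (Monomial β ι), t.length = l.length + 1 → (t.map deg).sum = (l.map deg).sum →
      (0 ∈ l → 0 ∈ t) → (1 ∈ l → 1 ∈ t) → p (F t)) : p (split st F l) := by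
  induction l generalizing st F with
  | nil => exact h0
  | cons a l ih =>
    rcases a with _ | _ | b | ⟨i, _ | m⟩
    · exact h0
    · exact h0
    · refine ih _ _ fun t h1 h2 h3 h4 => h _ (by simp [h1]) (by simp [h2]) ?_ ?_ <;>
        simp_all [zero_def, one_def]
    · rw [split]
      split_ifs
      · exact h0
      refine ih _ _ fun t h1 h2 h3 h4 => h _ (by simp [h1]) (by simp [h2]) ?_ ?_ <;>
        simp_all [zero_def, one_def]
    · rw [split]
      split_ifs
      · exact h0
      refine h _ (by simp) (by simp [deg]; omega) ?_ ?_ <;> simp [zero_def, one_def]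

theorem split_add (st : Option ι) (F G : List (Monomial β ι) → M) (l : List (Monomial β ι)) :
    split st (F + G) l = split st F l + split st G l := by
  induction l generalizing st F G with
  | nil => simp [split]
  | cons a l ih =>
    rcases a with _ | _ | b | ⟨i, _ | m⟩
    · simp [split]
    · simp [split]
    · exact ih _ (fun t => F (v b :: t)) (fun t => G (v b :: t))
    · simp only [split]
      split_ifs
      · simp
      · exact ih _ (fun t => F (x i 0 :: t)) (fun t => G (x i 0 :: t))
    · simp only [split]
      split_ifs <;> simp

theorem split_congr {st : Option ι} {F G : List (Monomial β ι) → M} {l : List (Monomial β ι)}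
    (h : ∀ t : List (Monomial β ι), (t.map deg).sum = (l.map deg).sum → F t = G t) :
    split st F l = split st G l := by
  induction l generalizing st F G with
  | nil => rfl
  | cons a l ih =>
    rcases a with _ | _ | b | ⟨i, _ | m⟩
    · rfl
    · rfl
    · exact ih fun t ht => h _ (by simp [ht])
    · simp only [split]
      split_ifs
      · rfl
      · exact ih fun t ht => h _ (by simp [ht])
    · simp only [split]
      split_ifs
      · rfl
      · exact h _ (by simp [deg]; omega)

theorem split_eq_zero {st : Option ι} {F : List (Monomial β ι) → M} {l : List (Monomial β ι)}
    (h : ∀ t, F t = 0) : split st F l = 0 :=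
  split_induction st F l (· = 0) rfl fun t _ _ _ _ => h t

theorem split_split (st : Option ι) (F : List (Monomial β ι) → M) (l : List (Monomial β ι)) :
    split st (split st F) l = 0 := by
  induction l generalizing st F with
  | nil => rfl
  | cons a l ih =>
    rcases a with _ | _ | b | ⟨i, _ | m⟩
    · rfl
    · rfl
    · exact ih _ _
    · rw [split]
      split_ifs with h
      · rfl
      · simp only [split, if_neg h]
        exact ih _ _
    · rw [split]
      split_ifs with h
      · rfl
      · cases m <;> simp [split, h]

theorem split_of_isKoszul {st : Option ι} {F : List (Monomial β ι) → M} {l : List (Monomial β ι)}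
    (h : IsKoszul st l) : split st F l = 0 := by
  induction l generalizing st F with
  | nil => rfl
  | cons a l ih =>
    rcases a with _ | _ | b | ⟨i, _ | m⟩
    · rfl
    · rfl
    · exact ih h
    · rw [split, if_neg h.1]
      exact ih h.2
    · exact h.elim

/-! ### The contraction -/

/-- Words with no letter `0` or `1`. -/
def IsProper (l : List (Monomial β ι)) : Prop := 0 ∉ l ∧ 1 ∉ l

/-- The first letter is not a power of the letter recorded by `st`. -/
def Compatible (st : Option ι) : List (Monomial β ι) → Prop
  | x i _ :: _ => st ≠ some i
  | _ => True

variable {Q : Type*} [CommRing Q] [Module Q M] (e : Monomial β ι →*₀ Q)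

theorem barD_append_singleton {F : List (Monomial β ι) → M} (hF : IsPointed F)
    {l : List (Monomial β ι)} {c : Monomial β ι} (h : IsKoszul none (l ++ [c])) :
    barD e F (l ++ [c]) = barLeft e F (l ++ [c]) + e c • F l := by
  rw [barD, barRight_append_singleton e hF h.isChain]

theorem koszul_cocycle {G : List (Monomial β ι) → M} (hG : IsPointed G) (hD : barD e G = 0)
    {i : ι} {l : List (Monomial β ι)} {c : Monomial β ι} (hw : IsKoszul (some i) (l ++ [c])) :
    e (x i 0) • G (l ++ [c]) + e c • G (x i 0 :: l) = 0 := by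
  have h1 : IsKoszul none ((x i 0 :: l) ++ [c]) := ⟨by simp, hw⟩
  have h2 := barD_append_singleton e hG h1
  rw [hD] at h2
  exact h2.symm

theorem barD_of_isKoszul {F : List (Monomial β ι) → M} (hF : IsPointed F)
    (hK : ∀ l, IsKoszul none l → F l = 0) {l : List (Monomial β ι)} (h : IsKoszul none l) :
    barD e F l = 0 := by
  have h0 : barRight e F l = 0 := by
    rcases List.eq_nil_or_concat' l with rfl | ⟨l, c, rfl⟩
    · rfl
    · rw [barRight_append_singleton e hF h.isChain, hK l h.of_append, smul_zero]
  rw [barD, h0, add_zero]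
  rcases l with _ | ⟨_ | _ | b | ⟨i, _ | m⟩, l⟩
  · rfl
  · exact h.elim
  · exact h.elim
  · simp [barLeft, hK l h]
  · simp [barLeft, hK l h.2.of_some]
  · exact h.elim

variable [Module (ZMod 2) M]

theorem split_contraction_power {st : Option ι} {F : List (Monomial β ι) → M} (hF : IsPointed F)
    (hK : ∀ l, IsKoszul st l → F l = 0) {i : ι} (hi : st ≠ some i) (m : ℕ)
    {l : List (Monomial β ι)} (hl : IsProper l) :
    barRight e (split st F) (x i (m + 1) :: l) + split st (barRight e F) (x i (m + 1) :: l) =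
      F (x i (m + 1) :: l) := by
  have h1 : (fun t => split st F (x i (m + 1) :: t)) = fun t => F (x i 0 :: x i m :: t) := by
    funext t; simp [split, hi]
  have h2 : absorb e (x i (m + 1)) (split st F) l =
      absorb e (x i m) (fun t => F (x i 0 :: t)) l := by
    rcases l with _ | ⟨_ | _ | c | ⟨j, n⟩, l⟩
    · simp [absorb, split, hK [x i 0] ⟨hi, trivial⟩]
    · exact (hl.1 (by simp [zero_def])).elim
    · exact (hl.2 (by simp [one_def])).elim
    · simp only [absorb, x_mul_v]
      rw [hF _ (by simp)]
      rfl
    · simp only [absorb]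
      by_cases hij : i = j
      · subst hij
        rw [x_mul_x_self, x_mul_x_self, split, if_neg hi, add_right_comm]
      · rw [x_mul_x hij, x_mul_x hij, hF _ (by simp)]
        rfl
  rw [barRight, h1, h2, split, if_neg hi]
  simp only [barRight]
  rw [absorb, x_mul_x_self, zero_add]
  have h3 := ZModModule.add_self (absorb e (x i m) (fun t => F (x i 0 :: t)) l)
  have h4 := ZModModule.add_self (barRight e (fun t => F (x i 0 :: x i m :: t)) l)
  linear_combination (norm := module) h3 + h4

/-- Splitting contracts the functions of words that vanish on Koszul words, with respect to the
differential without its first face. -/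
theorem split_contraction {st : Option ι} {F : List (Monomial β ι) → M} (hF : IsPointed F)
    (hK : ∀ l, IsKoszul st l → F l = 0) {l : List (Monomial β ι)} (hl : IsProper l)
    (hc : Compatible st l) :
    barRight e (split st F) l + split st (barRight e F) l = F l := by
  induction l generalizing st F with
  | nil => simp [barRight, split, hK [] trivial]
  | cons a l ih =>
    have hl' : IsProper l := ⟨fun h => hl.1 (by simp [h]), fun h => hl.2 (by simp [h])⟩
    rcases a with _ | _ | b | ⟨i, _ | m⟩
    · exact (hl.1 (by simp [zero_def])).elim
    · exact (hl.2 (by simp [one_def])).elim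
    · have h1 : (fun t => split st F (v b :: t)) = split none (fun t => F (v b :: t)) := rfl
      have h2 : (fun t => barRight e F (v b :: t)) =
        absorb e (v b) F + barRight e (fun t => F (v b :: t)) := rfl
      have hc' : Compatible none l := by
        rcases l with _ | ⟨_ | _ | c | ⟨j, n⟩, l⟩ <;> simp [Compatible]
      have h3 : absorb e (v b) (split st F) l = 0 := by
        rcases l with _ | ⟨_ | _ | c | ⟨j, n⟩, l⟩
        · simp [absorb, split]
        · rfl
        · exact (hl'.2 (by simp [one_def])).elim
        · rfl
        · rfl
      have h4 : split none (absorb e (v b) F) l = 0 := by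
        rcases l with _ | ⟨_ | _ | c | ⟨j, _ | n⟩, l⟩
        · rfl
        · rfl
        · rfl
        · rw [split]
          exact split_eq_zero fun t => hF (v b * v c :: t) (by simp [v_mul_v])
        · rw [split, if_neg (by simp)]
          exact split_eq_zero fun t => hF (v b * x j 0 :: t) (by simp [v_mul_x])
        · exact hF (v b * x j 0 :: x j n :: l) (by simp [v_mul_x])
      rw [barRight, h1, h3, split, h2, split_add, h4, zero_add, zero_add]
      exact ih (fun t ht => hF _ (by simp [ht])) (fun t ht => hK (v b :: t) ht) hl' hc'
    · have hi : st ≠ some i := hc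
      have h1 : (fun t => split st F (x i 0 :: t)) = split (some i) (fun t => F (x i 0 :: t)) := by
        funext t; rw [split, if_neg hi]
      have h2 : (fun t => barRight e F (x i 0 :: t)) =
        absorb e (x i 0) F + barRight e (fun t => F (x i 0 :: t)) := rfl
      rw [barRight, h1, split, if_neg hi, h2, split_add]
      by_cases hc' : Compatible (some i) l
      · have h3 : absorb e (x i 0) (split st F) l = 0 := by
          rcases l with _ | ⟨_ | _ | c | ⟨j, n⟩, l⟩
          · simp [absorb, split]
          · rfl
          · exact (hl'.2 (by simp [one_def])).elim
          · rfl
          · rw [absorb, x_mul_x (fun h => hc' (by rw [h]))]; rfl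
        have h4 : split (some i) (absorb e (x i 0) F) l = 0 := by
          rcases l with _ | ⟨_ | _ | c | ⟨j, _ | n⟩, l⟩
          · rfl
          · rfl
          · rfl
          · rw [split]
            exact split_eq_zero fun t => hF (x i 0 * v c :: t) (by simp [x_mul_v])
          · have hc2 : some i ≠ some j := hc'
            rw [split, if_neg hc2]
            refine split_eq_zero fun t => hF _ ?_
            rw [x_mul_x (fun h => hc2 (by rw [h]))]; simp
          · have hc2 : some i ≠ some j := hc'
            rw [split, if_neg hc2]
            refine hF _ ?_
            rw [x_mul_x (fun h => hc2 (by rw [h]))]; simp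
        rw [h3, h4, zero_add, zero_add]
        exact ih (fun t ht => hF _ (by simp [ht])) (fun t ht => hK (x i 0 :: t) ⟨hi, ht⟩) hl' hc'
      · rcases l with _ | ⟨_ | _ | c | ⟨j, n⟩, l⟩
        · exact (hc' trivial).elim
        · exact (hc' trivial).elim
        · exact (hc' trivial).elim
        · exact (hc' trivial).elim
        obtain rfl : i = j := by simpa [Compatible] using hc'
        have h5 : ∀ (G : List (Monomial β ι) → M) t, split (some i) G (x i n :: t) = 0 := by
          intro G t; cases n <;> simp [split]
        have h6 : barRight e (split (some i) fun t => F (x i 0 :: t)) (x i n :: l) = 0 := by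
          have h7 : (fun t => split (some i) (fun t => F (x i 0 :: t)) (x i n :: t)) = 0 :=
            funext (h5 _)
          rw [barRight, h7, barRight_zero, add_zero]
          rcases l with _ | ⟨_ | _ | c | ⟨j, p⟩, l⟩
          · simp [absorb, split]
          · rfl
          · exact (hl'.2 (by simp [one_def])).elim
          · rfl
          · rw [absorb]
            by_cases hij : i = j
            · subst hij; rw [x_mul_x_self]; simp [split]
            · rw [x_mul_x hij]; rfl
        rw [h6, h5, h5, absorb, x_mul_x_self, split, if_neg hi]
        simp
    · exact split_contraction_power e hF hK hc m hl'

end Monomial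

namespace Monomial

variable {β ι : Type*} {M : Type*} [AddCommGroup M] {Q : Type*} [CommRing Q] [Module Q M]
  (e : Monomial β ι →*₀ Q)

/-! ### Cocycles that vanish on Koszul words -/

theorem split_barLeft_congr (F : List (Monomial β ι) → M) {G G' : List (Monomial β ι) → M}
    {l : List (Monomial β ι)} (h : ∀ t : List (Monomial β ι),
      (t.map deg).sum < (l.map deg).sum → G t = G' t) :
    split none (F + barLeft e G) l = split none (F + barLeft e G') l := by
  rcases l with _ | ⟨_ | _ | b | ⟨i, _ | m⟩, l⟩
  · rfl
  · rfl
  · rfl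
  · rw [split, split]
    refine split_congr fun t ht => ?_
    simp [barLeft, h t (by simp [deg, ht])]
  · simp only [split]
    refine split_congr fun t ht => ?_
    simp [barLeft, h t (by simp [deg, ht])]
  · simp [split, barLeft, h (x i m :: l) (by simp [deg])]

/-- The perturbed equation `h = split (F + barLeft h)` is solved by iteration, since `barLeft`
lowers the degree of words. A property `p` that depends only on a word and on the value there
passes from the iterates to the solution. -/
theorem exists_fixedPoint (F : List (Monomial β ι) → M)
    (p : (List (Monomial β ι) → M) → List (Monomial β ι) → Prop)
    (hp : ∀ G l, p G l ↔ p (fun _ => G l) l) (h0 : ∀ l, p 0 l)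
    (hstep : ∀ G, (∀ l, p G l) → ∀ l, p (split none (F + barLeft e G)) l) :
    ∃ h : List (Monomial β ι) → M, h = split none (F + barLeft e h) ∧ ∀ l, p h l := by
  let T : (List (Monomial β ι) → M) → List (Monomial β ι) → M :=
    fun G => split none (F + barLeft e G)
  let H : ℕ → List (Monomial β ι) → M := fun k => T^[k] 0
  have hH : ∀ k, H (k + 1) = T (H k) := fun k => Function.iterate_succ_apply' T k 0
  have stable : ∀ k, ∀ l : List (Monomial β ι), (l.map deg).sum < k → H (k + 1) l = H k l := by
    intro k
    induction k with
    | zero => simp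
    | succ k ih =>
      intro l hl
      rw [hH, hH k]
      exact split_barLeft_congr e F fun t ht => by rw [← hH]; exact ih t (by omega)
  have stable' : ∀ j k, k ≤ j → ∀ l : List (Monomial β ι), (l.map deg).sum < k →
      H j l = H k l := by
    intro j k hjk l hl
    induction j, hjk using Nat.le_induction with
    | base => rfl
    | succ j hj ih => rw [stable j l (by omega), ih]
  refine ⟨fun l => H ((l.map deg).sum + 1) l, ?_, fun l => ?_⟩
  · funext l
    rw [hH]
    exact split_barLeft_congr e F fun t ht => (stable' _ _ (by omega) t (by omega))
  · have : ∀ k l, p (H k) l := by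
      intro k
      induction k with
      | zero => exact h0
      | succ k ih => rw [hH]; exact hstep _ ih
    rw [hp]
    exact (hp _ _).1 (this _ l)

section CharTwo

variable [Module (ZMod 2) M]

/-- A normalized cocycle that vanishes on Koszul words is a coboundary: the bar complex retracts
onto the Koszul complex. -/
theorem exists_primitive {P P' : ℕ → ℕ → AddSubgroup M}
    (hP : ∀ a k d m, m ∈ P k d → e a • m ∈ P k (d + deg a)) (hPP : ∀ k d, P' (k + 1) d = P k d)
    {F : List (Monomial β ι) → M} (hF : IsPointed F) (hn : ∀ l, 1 ∈ l → F l = 0)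
    (hg : IsGradedBy deg P' F) (hK : ∀ l, IsKoszul none l → F l = 0) (hD : barD e F = 0) :
    ∃ h : List (Monomial β ι) → M, IsPointed h ∧ IsGradedBy deg P h ∧ barD e h = F := by
  obtain ⟨h, hfix, hh⟩ := exists_fixedPoint e F
    (fun G l => (0 ∈ l ∨ 1 ∈ l → G l = 0) ∧ G l ∈ P l.length (l.map deg).sum)
    (fun _ _ => Iff.rfl) (fun l => ⟨fun _ => rfl, zero_mem _⟩) (by
      intro G hG l
      have h1 : ∀ t, 0 ∈ t ∨ 1 ∈ t → t ≠ [1] → split none (barLeft e G) t = 0 := by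
        intro t ht ht1
        rcases t with _ | ⟨_ | _ | b | ⟨i, _ | m⟩, t⟩
        · rfl
        · rfl
        · rfl
        · exact split_induction none _ t (· = 0) rfl fun s _ _ h2 h3 => by
            have := (hG s).1 (by simp [zero_def, one_def] at ht h2 h3 ⊢; tauto)
            simp [barLeft, this]
        · simp only [split]
          exact split_induction _ _ t (· = 0) rfl fun s _ _ h2 h3 => by
            have := (hG s).1 (by simp [zero_def, one_def] at ht h2 h3 ⊢; tauto)
            simp [barLeft, this]
        · have := (hG (x i m :: t)).1 (by simp [zero_def, one_def] at ht ⊢; tauto)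
          simp [split, barLeft, this]
      constructor
      · intro hl
        by_cases hl1 : l = [1]
        · subst hl1; rfl
        rw [split_add, h1 l hl hl1, add_zero]
        refine split_induction none F l (· = 0) rfl fun t _ _ h2 h3 => ?_
        rcases hl with hl | hl
        · exact hF t (h2 hl)
        · exact hn t (h3 hl)
      · refine split_induction none _ l _ (zero_mem _) fun t h2 h3 _ _ => ?_
        rw [← h3, ← hPP, ← h2]
        refine add_mem (hg t) ?_
        rcases t with _ | ⟨a, t⟩
        · exact zero_mem _
        · rw [List.length_cons, hPP, barLeft, List.map_cons, List.sum_cons, add_comm]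
          exact hP a _ _ _ (hG t).2)
  have hhp : IsPointed h := fun l hl => (hh l).1 (Or.inl hl)
  have hhn : ∀ l, 1 ∈ l → h l = 0 := fun l hl => (hh l).1 (Or.inr hl)
  refine ⟨h, hhp, fun l => (hh l).2, ?_⟩
  have hhK : ∀ l, IsKoszul none l → h l = 0 := fun l hl => by rw [hfix, split_of_isKoszul hl]
  have hsh : ∀ l, split none h l = 0 := fun l => by
    conv_lhs => rw [hfix]
    exact split_split _ _ _
  -- The difference `X` is a cocycle killed by `split`, hence fixed by an operator lowering degrees.
  set X := F + barD e h with hX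
  have hDX : barD e X = 0 := by rw [hX, barD_add, hD, barD_barD, add_zero]
  have hXp : IsPointed X := fun l hl => by simp [hX, hF l hl, hhp.barD e l hl]
  have hXn : ∀ l, 1 ∈ l → X l = 0 := by
    intro l hl
    obtain ⟨u, t, rfl⟩ := List.append_of_mem hl
    have h1 : IsNormalizedUpTo (u.length + 1) h := fun u t _ => hhn _ (by simp)
    rw [hX, Pi.add_apply, hn _ hl, h1.barD e u t (by omega), add_zero]
  have hXK : ∀ l, IsKoszul none l → X l = 0 := fun l hl => by
    rw [hX, Pi.add_apply, hK l hl, barD_of_isKoszul e hhp hhK hl, add_zero]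
  have hsX : ∀ l, split none X l = 0 := by
    intro l
    by_cases hl : IsProper l
    · have h1 := split_contraction e hhp hhK hl (by
        rcases l with _ | ⟨_ | _ | c | ⟨j, n⟩, l⟩ <;> simp [Compatible])
      have h2 : split none h = 0 := funext hsh
      have h3 : barD e h = barLeft e h + barRight e h := rfl
      have h4 : h l = split none F l + split none (barLeft e h) l := by
        conv_lhs => rw [hfix]
        exact split_add _ _ _ _
      rw [h2, barRight_zero, zero_add] at h1
      rw [hX, h3, split_add, split_add, h1, ← add_assoc, ← h4, ZModModule.add_self]
    · refine split_induction none X l (· = 0) rfl fun t _ _ h2 h3 => ?_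
      by_cases hl0 : 0 ∈ l
      · exact hXp t (h2 hl0)
      · exact hXn t (h3 (by by_contra h1; exact hl ⟨hl0, h1⟩))
  have hXeq : ∀ l, IsProper l → X l = split none (0 + barLeft e X) l := by
    intro l hl
    have h1 := split_contraction e hXp hXK hl (by
      rcases l with _ | ⟨_ | _ | c | ⟨j, n⟩, l⟩ <;> simp [Compatible])
    have h2 : split none X = 0 := funext hsX
    have h3 : split none (barLeft e X + barRight e X) l = 0 := by
      rw [show barLeft e X + barRight e X = barD e X from rfl, hDX]
      exact split_eq_zero fun _ => rfl
    rw [h2, barRight_zero, zero_add] at h1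
    rw [split_add, h1] at h3
    rw [zero_add]
    have h4 := ZModModule.add_self (split none (barLeft e X) l)
    linear_combination (norm := module) h3 - h4
  have hX0 : ∀ d, ∀ l : List (Monomial β ι), (l.map deg).sum = d → X l = 0 := by
    intro d
    induction d using Nat.strong_induction_on with
    | _ d ih =>
      intro l hl
      by_cases hlp : IsProper l
      · rw [hXeq l hlp, split_barLeft_congr e 0 (G' := 0) fun t ht => ih _ (hl ▸ ht) t rfl]
        exact split_eq_zero fun t => by cases t <;> simp [barLeft]
      · by_cases hl0 : 0 ∈ l
        · exact hXp l hl0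
        · exact hXn l (by by_contra h1; exact hlp ⟨hl0, h1⟩)
  funext l
  have h1 : F l + barD e h l = 0 := hX0 _ l rfl
  have h2 := ZModModule.add_self (barD e h l)
  linear_combination (norm := module) h2 - h1

/-- A cocycle of the bar complex is a coboundary if all cocycles in the same degrees agree on Koszul
words with a coboundary. -/
theorem exists_barD_eq {P P' : ℕ → ℕ → AddSubgroup M} {n : ℕ}
    (hP : ∀ a k d m, m ∈ P k d → e a • m ∈ P k (d + deg a)) (hPP : ∀ k d, P' (k + 1) d = P k d)
    (hn : ∀ k d, k ≠ n → P' k d = ⊥)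
    {F : List (Monomial β ι) → M} (hF : IsPointed F) (hg : IsGradedBy deg P' F)
    (hD : barD e F = 0)
    (H : ∀ G : List (Monomial β ι) → M, IsPointed G → IsGradedBy deg P' G → barD e G = 0 →
      ∃ g : List (Monomial β ι) → M, (∀ l, ¬ IsKoszul none l → g l = 0) ∧ IsGradedBy deg P g ∧
        ∀ w, IsKoszul none w → w.length = n → barD e g w = G w) :
    ∃ h : List (Monomial β ι) → M, IsPointed h ∧ IsGradedBy deg P h ∧ barD e h = F := by
  have graded : ∀ {f : List (Monomial β ι) → M}, IsPointed f → IsGradedBy deg P f →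
      IsGradedBy deg P' (barD e f) := by
    intro f hf hfg l
    cases l with
    | nil => simp [barD, barLeft, barRight, zero_mem]
    | cons a l => rw [List.length_cons, hPP]; exact barD_mem e deg_mul hP hf hfg a l
  obtain ⟨h, hp, hgr, hnorm⟩ := exists_normalized e deg_mul rfl hP hPP hF hg hD n
  set G := F + barD e h with hG
  have hGD : barD e G = 0 := by rw [hG, barD_add, hD, barD_barD, add_zero]
  have hGp : IsPointed G := fun l hl => by simp [hG, hF l hl, hp.barD e l hl]
  have hGg : IsGradedBy deg P' G := fun l => add_mem (hg l) (graded hp hgr l)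
  have hGn : ∀ l, 1 ∈ l → G l = 0 := by
    intro l hl
    by_cases hln : l.length = n
    · obtain ⟨u, t, rfl⟩ := List.append_of_mem hl
      exact hnorm u t (by simp at hln; omega)
    · simpa [hn _ _ hln] using hGg l
  obtain ⟨g, hgK, hgg, hgG⟩ := H G hGp hGg hGD
  have hgp : IsPointed g := fun l hl => hgK l fun h => h.isProper.1 hl
  obtain ⟨h', hp', hgr', hD'⟩ := exists_primitive e hP hPP (F := G + barD e g)
    (fun l hl => by simp [hGp l hl, hgp.barD e l hl])
    (fun l hl => by
      obtain ⟨u, t, rfl⟩ := List.append_of_mem hl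
      have h1 : IsNormalizedUpTo (u.length + 1) g :=
        fun u t _ => hgK _ fun h => h.isProper.2 (by simp)
      rw [Pi.add_apply, hGn _ hl, h1.barD e u t (by omega), add_zero])
    (fun l => add_mem (hGg l) (graded hgp hgg l))
    (fun l hl => by
      by_cases hln : l.length = n
      · rw [Pi.add_apply, hgG l hl hln, ZModModule.add_self]
      · simpa [hn _ _ hln] using add_mem (hGg l) (graded hgp hgg l))
    (by rw [barD_add, hGD, barD_barD, add_zero])
  refine ⟨h + g + h', fun l hl => by simp [hp l hl, hgp l hl, hp' l hl],
    fun l => add_mem (add_mem (hgr l) (hgg l)) (hgr' l), ?_⟩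
  rw [barD_add, barD_add, hD', hG]
  have h1 : ∀ f : List (Monomial β ι) → M, f + f = 0 := fun f => funext fun l =>
    ZModModule.add_self (f l)
  linear_combination (norm := module) h1 (barD e h) + h1 (barD e g)

end CharTwo

/-! ### The Koszul complex -/

theorem isKoszul_letter {l : List (Monomial β ι)} {c : Monomial β ι} {st : Option ι}
    (h : IsKoszul st (l ++ [c])) : (∃ b, c = v b) ∨ ∃ i, c = x i 0 := by
  induction l generalizing st with
  | nil => rcases c with _ | _ | b | ⟨i, _ | m⟩ <;> simp_all [IsKoszul]
  | cons a l ih =>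
    rcases a with _ | _ | b | ⟨i, _ | m⟩
    · exact h.elim
    · exact h.elim
    · exact ih (st := none) h
    · exact ih h.2
    · exact h.elim

theorem isKoszul_some_append_iff {l : List (Monomial β ι)} {c : Monomial β ι} (i : ι)
    (h : IsKoszul none (l ++ [c])) (hl : l ≠ []) :
    IsKoszul (some i) (l ++ [c]) ↔ IsKoszul (some i) l := by
  refine ⟨fun h => h.of_append, fun h' => ?_⟩
  rcases l with _ | ⟨_ | _ | b | ⟨j, _ | m⟩, l⟩
  · exact (hl rfl).elim
  · exact h.elim
  · exact h.elim
  · exact h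
  · exact ⟨h'.1, h.2⟩
  · exact h.elim

open Classical in
/-- Exactness of the Koszul complex with coefficients in a product of the lines `ε i B` on each of
which exactly one letter `xᵢ` acts, as an isomorphism. The maps `u`, `u'`, `u''` are the inclusions
of `B` in three consecutive degrees of the coefficients. -/
theorem exists_koszul_primitive [Fintype ι] {B : Type*} [BooleanRing B] {ε : ι → B}
    (hε : ∑ i, ε i = 1) (hεε : ∀ i j, i ≠ j → ε i * ε j = 0) {u u' u'' : B →+ M}
    (hu : ∀ i b, e (x i 0) • u b = u' (ε i * b)) (hu' : ∀ i b, e (x i 0) • u' b = u'' (ε i * b))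
    (hv : ∀ c b, e (v c) • u b = 0) (hv' : ∀ c b, e (v c) • u' b = 0)
    (hinj : Function.Injective u'') {n : ℕ} (hn : 2 ≤ n) {G : List (Monomial β ι) → M}
    (hG : IsPointed G) (hD : barD e G = 0)
    (hGu : ∀ w, IsKoszul none w → w.length = n → ∃ b, G w = u' b) :
    ∃ g : List (Monomial β ι) → M,
      (∀ l, g l = 0 ∨ IsKoszul none l ∧ l.length + 1 = n ∧ ∃ b, g l = u b) ∧
      ∀ w, IsKoszul none w → w.length = n → barD e g w = G w := by
  choose! b hb using hGu
  let s : List (Monomial β ι) → B := fun l =>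
    ∑ i, if IsKoszul (some i) l then ε i * b (x i 0 :: l) else 0
  have hs : ∀ k l, ε k * s l = if IsKoszul (some k) l then ε k * b (x k 0 :: l) else 0 := by
    intro k l
    rw [Finset.mul_sum, Finset.sum_eq_single k]
    · split_ifs
      · rw [← mul_assoc, BooleanRing.mul_self]
      · rw [mul_zero]
    · intro j _ hj
      split_ifs
      · rw [← mul_assoc, hεε k j hj.symm, zero_mul]
      · rw [mul_zero]
    · simp
  let g : List (Monomial β ι) → M := fun l =>
    if IsKoszul none l ∧ l.length + 1 = n then u (s l) else 0
  have hgp : IsPointed g := fun l hl => if_neg fun h => h.1.isProper.1 hl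
  refine ⟨g, fun l => ?_, fun w hw hwn => ?_⟩
  · by_cases h : IsKoszul none l ∧ l.length + 1 = n
    · exact Or.inr ⟨h.1, h.2, s l, if_pos h⟩
    · exact Or.inl (if_neg h)
  -- The first face of `g` gives the components whose letter starts the word `w`.
  have h1 : barLeft e g w = u' (∑ i, if IsKoszul (some i) w then 0 else ε i * b w) := by
    rcases w with _ | ⟨_ | _ | c | ⟨k, _ | m⟩, l⟩
    · simp at hwn; omega
    · exact hw.elim
    · exact hw.elim
    · have h0 : ∀ i, IsKoszul (some i) (v c :: l) := fun i => hw
      simp only [h0, if_true, Finset.sum_const_zero, map_zero, barLeft]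
      by_cases h : IsKoszul none l ∧ l.length + 1 = n
      · rw [show g l = u (s l) from if_pos h, hv]
      · rw [show g l = 0 from if_neg h, smul_zero]
    · have h0 : ∀ i, IsKoszul (some i) (x k 0 :: l) ↔ i ≠ k := fun i => by simp [IsKoszul, hw.2]
      simp only [h0, barLeft]
      rw [show g l = u (s l) from if_pos ⟨hw.2.of_some, hwn⟩, hu, hs, if_pos hw.2]
      simp
    · exact hw.elim
  obtain rfl | ⟨l, c, rfl⟩ := List.eq_nil_or_concat' w
  · simp at hwn; omega
  have hln : l.length + 1 = n := by simpa using hwn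
  have hl : l ≠ [] := by rintro rfl; simp at hln; omega
  -- The other components come from the last face, by the cocycle condition on `xᵢ w`.
  have h2 : e c • g l =
      u' (∑ i, if IsKoszul (some i) (l ++ [c]) then ε i * b (l ++ [c]) else 0) := by
    rw [show g l = u (s l) from if_pos ⟨hw.of_append, hln⟩]
    have hc : ∀ i, IsKoszul (some i) (l ++ [c]) →
        u'' (ε i * b (l ++ [c])) + e c • u' (b (x i 0 :: l)) = 0 := by
      intro i hi
      have h3 := koszul_cocycle e hG hD hi
      rwa [hb _ hw hwn, hb (x i 0 :: l) ⟨by simp, hi.of_append⟩ hln, hu'] at h3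
    rcases isKoszul_letter hw with ⟨d, rfl⟩ | ⟨k, rfl⟩
    · rw [hv, Finset.sum_eq_zero, map_zero]
      intro i _
      split_ifs with hi
      · have h3 := hc i hi
        rw [hv', add_zero] at h3
        exact hinj (by rw [h3, map_zero])
      · rfl
    · rw [hu, hs]
      congr 1
      have h3 : ∀ i, IsKoszul (some i) (l ++ [x k 0]) →
          ε i * b (l ++ [x k 0]) = ε k * b (x i 0 :: l) := by
        intro i hi
        have h3 := hc i hi
        rw [hu', ← map_add] at h3
        have h4 : ε i * b (l ++ [x k 0]) + ε k * b (x i 0 :: l) = 0 := hinj (by rw [h3, map_zero])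
        have h5 := BooleanRing.add_self (ε k * b (x i 0 :: l))
        linear_combination h4 - h5
      rw [Finset.sum_eq_single k]
      · rw [isKoszul_some_append_iff k hw hl]
        split_ifs with h4
        · rw [h3 k ((isKoszul_some_append_iff k hw hl).2 h4)]
        · rfl
      · intro i _ hik
        split_ifs with hi
        · rw [← BooleanRing.mul_self (ε i), mul_assoc, h3 i hi, ← mul_assoc, hεε i k hik, zero_mul]
        · rfl
      · simp
  rw [barD_append_singleton e hgp hw, h1, h2, ← map_add, ← Finset.sum_add_distrib, hb _ hw hwn]
  congr 1
  have h3 : ∑ i, ε i * b (l ++ [c]) = b (l ++ [c]) := by rw [← Finset.sum_mul, hε, one_mul]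
  refine Eq.trans (Finset.sum_congr rfl fun i _ => ?_) h3
  split_ifs <;> simp

end Monomial

/-! ### From multilinear maps to functions of words -/

section Multilinear

open Module

theorem exists_multilinearMap_basis {R A M J : Type*} [CommRing R] [AddCommGroup A] [Module R A]
    [AddCommGroup M] [Module R M] (b : Basis J R A) :
    ∀ (n : ℕ) (φ : (Fin n → J) → M),
      ∃ f : MultilinearMap R (fun _ : Fin n => A) M, ∀ j : Fin n → J, f (fun i => b (j i)) = φ j
  | 0, φ => ⟨MultilinearMap.constOfIsEmpty R _ (φ Fin.elim0), fun j => by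
      rw [Subsingleton.elim j Fin.elim0]; rfl⟩
  | n + 1, φ => by
    choose f hf using fun j₀ => exists_multilinearMap_basis b n fun j => φ (Fin.cons j₀ j)
    refine ⟨(b.constr R f).uncurryLeft, fun j => ?_⟩
    rw [LinearMap.uncurryLeft_apply, Basis.constr_basis]
    exact (hf (j 0) (Fin.tail j)).trans (by rw [Fin.cons_self_tail])

theorem MultilinearMap.apply_mem_of_mem_span {R A M ι : Type*} [CommRing R] [AddCommGroup A]
    [Module R A] [AddCommGroup M] [Module R M] [Finite ι]
    (f : MultilinearMap R (fun _ : ι => A) M) (S : ι → Set A) (N : Submodule R M)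
    (hS : ∀ a : ι → A, (∀ i, a i ∈ S i) → f a ∈ N) (a : ι → A)
    (ha : ∀ i, a i ∈ Submodule.span R (S i)) : f a ∈ N := by
  classical
  cases nonempty_fintype ι
  have key : ∀ (T : Finset ι) (a : ι → A), (∀ i ∈ T, a i ∈ Submodule.span R (S i)) →
      (∀ i ∉ T, a i ∈ S i) → f a ∈ N := by
    intro T
    induction T using Finset.induction_on with
    | empty => exact fun a _ h => hS a fun i => h i (by simp)
    | insert i₀ T hi₀ ih =>
      intro a h1 h2
      have h3 : ∀ y ∈ Submodule.span R (S i₀), f (Function.update a i₀ y) ∈ N := by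
        intro y hy
        induction hy using Submodule.span_induction with
        | mem y hy =>
          refine ih _ (fun i hi => ?_) fun i hi => ?_
          · rw [Function.update_of_ne ((by rintro rfl; exact hi₀ hi))]
            exact h1 i (by simp [hi])
          · by_cases h : i = i₀
            · subst h; simpa using hy
            · rw [Function.update_of_ne h]
              exact h2 i (by simp [h, hi])
        | zero => simp
        | add y z _ _ hy hz => rw [f.map_update_add]; exact add_mem hy hz
        | smul c y _ hy => rw [f.map_update_smul]; exact N.smul_mem c hy
      simpa using h3 (a i₀) (h1 i₀ (by simp))
  exact key Finset.univ a (fun i _ => ha i) (by simp)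

end Multilinear

section Comparison

variable {Γ : Type*} [MonoidWithZero Γ] {Q : Type*} [CommRing Q]
  {M : Type*} [AddCommGroup M] [Module Q M] (e : Γ →*₀ Q)

theorem mergeAt_zero {n : ℕ} (a : Fin (n + 2) → Q) :
    mergeAt 0 a = Fin.cons (a 0 * a 1) (Fin.tail (Fin.tail a)) := by
  funext i
  refine Fin.cases ?_ (fun i => ?_) i
  · simp [mergeAt]
  · simp [mergeAt, Fin.tail]

theorem mergeAt_succ {n : ℕ} (j : Fin n) (a : Fin (n + 2) → Q) :
    mergeAt j.succ a = Fin.cons (a 0) (mergeAt j (Fin.tail a)) := by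
  funext i
  refine Fin.cases ?_ (fun i => ?_) i
  · simp [mergeAt]
  · simp [mergeAt, Fin.tail]

theorem sum_mergeAt_eq_barRight {n : ℕ} (f : (Fin n → Q) → M) (F : List Γ → M)
    (hF : ∀ g : Fin n → Γ, F (List.ofFn g) = f (fun i => e (g i))) (a : Fin (n + 1) → Γ) :
    ∑ j : Fin n, f (mergeAt j fun i => e (a i)) +
      e (a (Fin.last n)) • f (Fin.init fun i => e (a i)) = barRight e F (List.ofFn a) := by
  induction n generalizing F with
  | zero =>
    have h0 := hF Fin.elim0
    rw [List.ofFn_zero] at h0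
    simp [barRight, absorb, h0]
    congr 2
    exact Subsingleton.elim _ _
  | succ n ih =>
    have h1 : ∀ g : Fin n → Γ, F (a 0 :: List.ofFn g) =
        f (Fin.cons (e (a 0)) fun i => e (g i)) := by
      intro g
      have := hF (Fin.cons (a 0) g)
      rw [List.ofFn_cons] at this
      rw [this]
      congr 1
      funext i
      refine Fin.cases ?_ (fun i => ?_) i <;> simp
    have h2 := ih (fun t => f (Fin.cons (e (a 0)) t)) (fun t => F (a 0 :: t)) h1 (Fin.tail a)
    rw [List.ofFn_succ, barRight, Fin.sum_univ_succ, add_assoc]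
    congr 1
    · rw [List.ofFn_succ, absorb, mergeAt_zero]
      have := hF (Fin.cons (a 0 * a 1) (Fin.tail (Fin.tail a)))
      rw [List.ofFn_cons] at this
      refine Eq.trans ?_ this.symm
      congr 1
      funext i
      refine Fin.cases ?_ (fun i => ?_) i <;> simp [Fin.tail]
    · refine Eq.trans ?_ h2
      congr 1
      · refine Finset.sum_congr rfl fun j _ => ?_
        rw [mergeAt_succ]
        rfl
      · congr 2
        funext i
        refine Fin.cases ?_ (fun i => ?_) i <;> simp [Fin.init, Fin.tail]

variable [Module (ZMod 2) M]

open Classical in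
/-- The values allowed at a word of length `k` and degree `d` for a cochain in `n` variables of
internal degree `s`. -/
def cochainValues (ℳ : ℤ → Submodule (ZMod 2) M) (n : ℕ) (s : ℤ) (k d : ℕ) : AddSubgroup M :=
  if k = n then (ℳ (d + s)).toAddSubgroup else ⊥

theorem cochainValues_succ (ℳ : ℤ → Submodule (ZMod 2) M) (n : ℕ) (s : ℤ) (k d : ℕ) :
    cochainValues ℳ (n + 1) s (k + 1) d = cochainValues ℳ n s k d := by
  simp [cochainValues]

theorem cochainValues_of_ne (ℳ : ℤ → Submodule (ZMod 2) M) (n : ℕ) (s : ℤ) (k d : ℕ) (h : k ≠ n) :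
    cochainValues ℳ n s k d = ⊥ := by
  simp [cochainValues, h]

theorem mem_cochainValues {ℳ : ℤ → Submodule (ZMod 2) M} {n : ℕ} {s : ℤ} {d : ℕ} {m : M} :
    m ∈ cochainValues ℳ n s n d ↔ m ∈ ℳ (d + s) := by
  simp [cochainValues]

theorem smul_mem_cochainValues {deg : Γ → ℕ} {ℳ : ℤ → Submodule (ZMod 2) M}
    (hM : ∀ (a : Γ) (d : ℤ) (m : M), m ∈ ℳ d → e a • m ∈ ℳ (d + deg a)) (n : ℕ) (s : ℤ)
    (a : Γ) (k d : ℕ) (m : M) (hm : m ∈ cochainValues ℳ n s k d) :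
    e a • m ∈ cochainValues ℳ n s k (d + deg a) := by
  by_cases h : k = n
  · subst h
    rw [mem_cochainValues] at hm ⊢
    have := hM a _ m hm
    rwa [add_right_comm, ← Nat.cast_add] at this
  · rw [cochainValues_of_ne _ _ _ _ _ h, AddSubgroup.mem_bot] at *
    rw [hm, smul_zero]

variable [Algebra (ZMod 2) Q] [IsScalarTower (ZMod 2) Q M]

theorem hochschildD_apply_eq_barD {n : ℕ} (f : MultilinearMap (ZMod 2) (fun _ : Fin n => Q) M)
    (F : List Γ → M) (hF : ∀ g : Fin n → Γ, F (List.ofFn g) = f (fun i => e (g i)))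
    (a : Fin (n + 1) → Γ) :
    hochschildD (ZMod 2) Q M n f (fun i => e (a i)) = barD e F (List.ofFn a) := by
  have h1 : ∀ m : ℕ, (-1 : ZMod 2) ^ m = 1 := fun m => by
    rw [show (-1 : ZMod 2) = 1 from rfl, one_pow]
  have h2 : hochschildD (ZMod 2) Q M n f (fun i => e (a i)) =
      e (a 0) • f (fun i => e (Fin.tail a i)) + (∑ j : Fin n, f (mergeAt j fun i => e (a i)) +
      e (a (Fin.last n)) • f (Fin.init fun i => e (a i))) := by
    simp only [hochschildD, LinearMap.coe_mk, AddHom.coe_mk, h1, one_smul]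
    rw [← add_assoc]
    simp [hochschildFirst, hochschildMiddle, hochschildLast]
    rfl
  rw [h2, sum_mergeAt_eq_barRight e f F hF, List.ofFn_succ, barD, barLeft, ← hF]
  rfl

/-- Hochschild cohomology vanishes if the graded pointed cocycles on words in a multiplicative
basis of the algebra are coboundaries. -/
theorem subsingleton_HH_of_barD {deg : Γ → ℕ}
    (hdeg : ∀ a b, a * b ≠ 0 → deg (a * b) = deg a + deg b)
    {J : Type*} (bs : Module.Basis J (ZMod 2) Q) (γ : J → Γ) (hγ : ∀ j, e (γ j) = bs j)
    (hγ' : ∀ g, g = 0 ∨ ∃ j, g = γ j)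
    (𝒜 : ℕ → Submodule (ZMod 2) Q) (ℳ : ℤ → Submodule (ZMod 2) M)
    (hA : ∀ g, g ≠ 0 → e g ∈ 𝒜 (deg g))
    (hspan : ∀ d, 𝒜 d ≤ Submodule.span (ZMod 2) {q | ∃ g, deg g = d ∧ q = e g})
    (hM : ∀ (a : Γ) (d : ℤ) (m : M), m ∈ ℳ d → e a • m ∈ ℳ (d + deg a))
    (n : ℕ) (s : ℤ)
    (H : ∀ F : List Γ → M, IsPointed F → IsGradedBy deg (cochainValues ℳ (n + 1) s) F →
      barD e F = 0 →
      ∃ h, IsPointed h ∧ IsGradedBy deg (cochainValues ℳ n s) h ∧ barD e h = F) :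
    Subsingleton (HH 𝒜 ℳ (n + 1) s) := by
  rw [Submodule.Quotient.subsingleton_iff, eq_top_iff]
  rintro ⟨f, hf, hfD⟩ -
  rw [Submodule.submoduleOf, Submodule.mem_comap, Submodule.subtype_apply]
  let F : List Γ → M := fun l =>
    if l.length = n + 1 then f (fun i => e (l.getD i 0)) else 0
  have hF : ∀ g : Fin (n + 1) → Γ, F (List.ofFn g) = f (fun i => e (g i)) := by
    intro g
    refine (if_pos List.length_ofFn).trans ?_
    congr 1
    funext i
    rw [List.getD_eq_getElem _ _ (by rw [List.length_ofFn]; exact i.2), List.getElem_ofFn]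
  have ofFn : ∀ {k : ℕ} {l : List Γ}, l.length = k → ∃ g : Fin k → Γ, l = List.ofFn g := by
    rintro k l rfl
    exact ⟨l.get, (List.ofFn_get l).symm⟩
  have hFp : IsPointed F := by
    intro l hl
    by_cases hln : l.length = n + 1
    · obtain ⟨g, rfl⟩ := ofFn hln
      rw [hF]
      obtain ⟨i, hi⟩ := (List.mem_ofFn' g 0).1 hl
      exact f.map_coord_zero i (by simp [hi])
    · exact if_neg hln
  have hFg : IsGradedBy deg (cochainValues ℳ (n + 1) s) F := by
    intro l
    by_cases hl0 : 0 ∈ l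
    · rw [hFp l hl0]; exact zero_mem _
    by_cases hln : l.length = n + 1
    · rw [hln, mem_cochainValues]
      obtain ⟨g, rfl⟩ := ofFn hln
      rw [hF, List.map_ofFn, List.sum_ofFn]
      refine hf (fun i => deg (g i)) _ fun i => hA _ fun h => hl0 ?_
      exact (List.mem_ofFn' g 0).2 ⟨i, h⟩
    · rw [show F l = 0 from if_neg hln]; exact zero_mem _
  have hFD : barD e F = 0 := by
    funext l
    rcases l with _ | ⟨a, l⟩
    · simp [barD, barLeft, barRight]
    by_cases hln : l.length = n + 1
    · obtain ⟨g, hg⟩ := ofFn (l := a :: l) (k := n + 2) (by simp [hln])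
      rw [hg, ← hochschildD_apply_eq_barD e f F hF, LinearMap.mem_ker.1 hfD]
      rfl
    · have := barD_mem e hdeg (smul_mem_cochainValues e hM (n + 1) s) hFp hFg a l
      rwa [cochainValues_of_ne _ _ _ _ _ hln, AddSubgroup.mem_bot] at this
  obtain ⟨h, hp, hg, hD⟩ := H F hFp hFg hFD
  obtain ⟨h', hh'⟩ := exists_multilinearMap_basis bs n fun j => h (List.ofFn fun i => γ (j i))
  have hh : ∀ g : Fin n → Γ, h (List.ofFn g) = h' (fun i => e (g i)) := by
    intro g
    by_cases hg0 : ∃ i, g i = 0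
    · obtain ⟨i, hi⟩ := hg0
      rw [hp _ ((List.mem_ofFn' g 0).2 ⟨i, hi⟩)]
      exact (h'.map_coord_zero i (by simp [hi])).symm
    · push Not at hg0
      choose j hj using fun i => (hγ' (g i)).resolve_left (hg0 i)
      obtain rfl : g = fun i => γ (j i) := funext hj
      simp only [hγ, hh']
  refine ⟨h', ?_, ?_⟩
  · intro d a ha
    refine h'.apply_mem_of_mem_span (fun i => {q | ∃ g, deg g = d i ∧ q = e g}) _ ?_ a
      fun i => hspan _ (ha i)
    intro b hb
    choose g hgd hge using hb
    obtain rfl : b = fun i => e (g i) := funext hge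
    have h1 := hg (List.ofFn g)
    rw [List.length_ofFn, mem_cochainValues, List.map_ofFn, List.sum_ofFn, hh] at h1
    simpa [hgd] using h1
  · refine Module.Basis.ext_multilinear (fun _ => bs) fun j => ?_
    have h1 := hochschildD_apply_eq_barD e h' h hh fun i => γ (j i)
    rw [hD, hF] at h1
    simpa [hγ] using h1

end Comparison

/-! ### Finite Boolean rings -/

section FiniteBoolean

open Module

theorem BooleanRing.nonempty_ringEquiv_zmod_two (K : Type*) [CommRing K] [IsDomain K]
    [Algebra (ZMod 2) K] (h : ∀ x : K, x * x = x) : Nonempty (K ≃+* ZMod 2) := by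
  refine ⟨(RingEquiv.ofBijective (algebraMap (ZMod 2) K) ⟨RingHom.injective _, fun x => ?_⟩).symm⟩
  rcases IsIdempotentElem.iff_eq_zero_or_one.1 (h x) with rfl | rfl
  · exact ⟨0, map_zero _⟩
  · exact ⟨1, map_one _⟩

/-- A finite Boolean ring has a basis of orthogonal idempotents with sum one. -/
theorem BooleanRing.exists_basis (A : Type*) [BooleanRing A] [Finite A] :
    ∃ (r : ℕ) (ε : Basis (Fin r) (ZMod 2) A), ∑ i, ε i = 1 ∧ (∀ i j, i ≠ j → ε i * ε j = 0) ∧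
      Nat.card A = 2 ^ r := by
  have hred : IsReduced A := ⟨fun x ⟨n, hn⟩ => by
    rcases n with _ | n
    · rw [pow_zero] at hn
      rw [← mul_one x, hn, mul_zero]
    · rwa [IsIdempotentElem.pow_succ_eq n (BooleanRing.mul_self x)] at hn⟩
  have h1 : ∀ I : MaximalSpectrum A, Nonempty ((A ⧸ I.asIdeal) ≃+* ZMod 2) := fun I =>
    have : I.asIdeal.IsMaximal := I.isMaximal
    BooleanRing.nonempty_ringEquiv_zmod_two _ fun x => by
      obtain ⟨a, rfl⟩ := Ideal.Quotient.mk_surjective x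
      rw [← map_mul, BooleanRing.mul_self]
  obtain ⟨r, ⟨σ⟩⟩ := Finite.exists_equiv_fin (MaximalSpectrum A)
  let φ : A ≃+* (Fin r → ZMod 2) :=
    ((IsArtinianRing.equivPi A).toRingEquiv.trans
      (RingEquiv.piCongrRight fun I => Classical.choice (h1 I))).trans
      (RingEquiv.piCongrLeft (fun _ => ZMod 2) σ)
  let ψ : A ≃ₗ[ZMod 2] (Fin r → ZMod 2) :=
    { φ with map_smul' := fun c x => ZMod.map_smul φ.toAddMonoidHom c x }
  have hψ : ∀ i, (Basis.ofEquivFun ψ) i = φ.symm (Pi.single i 1) := fun i => by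
    rw [Basis.coe_ofEquivFun]
    rfl
  refine ⟨r, Basis.ofEquivFun ψ, ?_, fun i j hij => ?_, ?_⟩
  · simp only [hψ]
    rw [← map_sum, ← map_one φ.symm]
    congr 1
    exact Finset.univ_sum_single (1 : Fin r → ZMod 2)
  · rw [hψ, hψ, ← map_mul, ← map_zero φ.symm]
    congr 1
    funext k
    simp only [Pi.mul_apply, Pi.zero_apply, Pi.single_apply]
    split_ifs <;> simp_all
  · rw [Nat.card_congr φ.toEquiv]
    simp

end FiniteBoolean

/-! ### The monomial basis of `V_* ⊓ A_*` -/

section DualBoolBasis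

open Module

variable {V : Type*} [AddCommGroup V]

/-- The element `v + b Xᵖ` of positive degree. -/
def DualBool.pos {B : Type*} [BooleanRing B] (v : DualPos V) (p : ℕ+) (b : B) : DualBool V B :=
  Unitization.inr (v, AddMonoidAlgebra.single p b)

namespace DualBool

variable {B : Type*} [BooleanRing B]

theorem pos_add_pos (v w : DualPos V) (p : ℕ+) (a b : B) :
    pos v p a + pos w p b = pos (v + w) p (a + b) := by
  rw [pos, pos, pos, ← Unitization.inr_add, Prod.mk_add_mk, ← AddMonoidAlgebra.single_add]

theorem pos_zero_zero (p : ℕ+) : pos (0 : DualPos V) p (0 : B) = 0 := by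
  rw [pos, AddMonoidAlgebra.single_zero]
  rfl

theorem pos_zero_injective (p : ℕ+) :
    Function.Injective (pos (0 : DualPos V) p : B → DualBool V B) := by
  intro a b h
  have h1 := Unitization.inr_injective h
  have h2 := congrArg (fun z => z.2.coeff p) h1
  simpa using h2

variable [Module (ZMod 2) V]

theorem pos_mul_pos (v w : DualPos V) (p q : ℕ+) (a b : B) :
    pos v p a * pos w q b = pos 0 (p + q) (a * b) := by
  rw [pos, pos, ← Unitization.inr_mul, Prod.mk_mul_mk, AddMonoidAlgebra.single_mul_single]
  rfl

theorem smul_pos (c : ZMod 2) (v : DualPos V) (p : ℕ+) (b : B) :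
    c • pos v p b = pos (c • v) p (c • b) := by
  rw [pos, pos, ← Unitization.inr_smul, Prod.smul_mk, AddMonoidAlgebra.smul_single]

theorem map_pos {A : Type*} [BooleanRing A] (φ : A →+* B) (v : DualPos V) (p : ℕ+) (a : A) :
    DualBool.map V φ (pos v p a) = pos v p (φ a) := by
  simp [DualBool.map, pos, BoolPos.map]

theorem mem_grading_zero {z : DualBool V B} :
    z ∈ dualBoolGrading V B 0 ↔ ∃ c : ZMod 2, z = algebraMap _ _ c := by
  simp only [dualBoolGrading, connectedSumGrading, unitGrading, LinearMap.mem_range,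
    Algebra.linearMap_apply, eq_comm]

theorem mem_grading_succ {z : DualBool V B} {n : ℕ} :
    z ∈ dualBoolGrading V B (n + 1) ↔
      ∃ (v : DualPos V) (b : B), (n ≠ 0 → v = 0) ∧ z = pos v n.succPNat b := by
  have hn : n.succPNat = 1 ↔ n = 0 := by
    rw [← PNat.coe_inj]; simp
  simp only [dualBoolGrading, connectedSumGrading, unitGrading, Submodule.mem_map]
  constructor
  · rintro ⟨⟨v, _⟩, ⟨h1, b, rfl⟩, rfl⟩
    refine ⟨v, b, fun h => ?_, rfl⟩
    simpa [DualPos.grading, hn, h] using h1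
  · rintro ⟨v, b, h, rfl⟩
    refine ⟨(v, AddMonoidAlgebra.single n.succPNat b), ⟨?_, b, rfl⟩, rfl⟩
    by_cases h0 : n = 0
    · rw [DualPos.grading, if_pos (hn.2 h0)]
      trivial
    · simp only [DualPos.grading, hn, h0, if_false]
      exact h h0

theorem smul_def (A : Subring B) (q : DualBool V A) (m : DualBool V B) :
    q • m = DualBool.map V A.subtype q * m := rfl

end DualBool

variable [Module (ZMod 2) V]

/-- The monomials in `V_* ⊓ A_*` for a family of vectors of `V` and a family of orthogonal
idempotents of `A`. -/
def monomialEval {A β ι : Type*} [BooleanRing A] (b : β → DualPos V) (ε : ι → A)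
    (hε : ∀ i j, i ≠ j → ε i * ε j = 0) : Monomial β ι →*₀ DualBool V A where
  toFun
    | .zero => 0
    | .one => 1
    | .v c => DualBool.pos (b c) 1 0
    | .x i m => DualBool.pos 0 m.succPNat (ε i)
  map_zero' := rfl
  map_one' := rfl
  map_mul' := by
    rintro (_ | _ | c | ⟨i, m⟩) (_ | _ | d | ⟨j, n⟩)
    · exact (zero_mul _).symm
    · exact (zero_mul _).symm
    · exact (zero_mul _).symm
    · exact (zero_mul _).symm
    · exact (mul_zero _).symm
    · exact (mul_one _).symm
    · exact (one_mul _).symm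
    · exact (one_mul _).symm
    · exact (mul_zero _).symm
    · exact (mul_one _).symm
    · simp [Monomial.v_mul_v, Monomial.zero_def, DualBool.pos_mul_pos, DualBool.pos_zero_zero]
    · simp [Monomial.v_mul_x, Monomial.zero_def, DualBool.pos_mul_pos, DualBool.pos_zero_zero]
    · exact (mul_zero _).symm
    · exact (mul_one _).symm
    · simp [Monomial.x_mul_v, Monomial.zero_def, DualBool.pos_mul_pos, DualBool.pos_zero_zero]
    · by_cases hij : i = j
      · subst hij
        simp only [Monomial.x_mul_x_self, DualBool.pos_mul_pos, BooleanRing.mul_self]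
        congr 1
        rw [← PNat.coe_inj]
        simp only [Nat.succPNat_coe, PNat.add_coe]
        omega
      · simp [Monomial.x_mul_x hij, Monomial.zero_def, DualBool.pos_mul_pos, hε i j hij,
          DualBool.pos_zero_zero]

section

variable {A β ι : Type*} [BooleanRing A] (b : β → DualPos V) (ε : ι → A)
  (hε : ∀ i j, i ≠ j → ε i * ε j = 0)

theorem monomialEval_v (c : β) : monomialEval b ε hε (.v c) = DualBool.pos (b c) 1 0 := rfl

theorem monomialEval_x (i : ι) (m : ℕ) :
    monomialEval b ε hε (.x i m) = DualBool.pos 0 m.succPNat (ε i) := rfl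

end

/-- The nonzero monomials form a basis. -/
theorem exists_monomialBasis {A β ι : Type*} [BooleanRing A] (b : Basis β (ZMod 2) (DualPos V))
    (ε : Basis ι (ZMod 2) A) (hε : ∀ i j, i ≠ j → ε i * ε j = 0) :
    ∃ (bs : Basis (Unit ⊕ (β ⊕ (Σ _ : ℕ+, ι))) (ZMod 2) (DualBool V A))
      (γ : Unit ⊕ (β ⊕ (Σ _ : ℕ+, ι)) → Monomial β ι),
      (∀ j, monomialEval b ε hε (γ j) = bs j) ∧ ∀ g, g = 0 ∨ ∃ j, g = γ j := by
  let a' : Basis (Σ _ : ℕ+, ι) (ZMod 2) (BoolPos A) :=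
    (Finsupp.basis fun _ => ε).map (AddMonoidAlgebra.coeffLinearEquiv (ZMod 2)).symm
  refine ⟨((Basis.singleton Unit (ZMod 2)).prod (b.prod a')).map
    (Unitization.linearEquiv (ZMod 2) (ZMod 2) (DualPos V × BoolPos A)).symm,
    fun j => match j with
      | .inl _ => .one
      | .inr (.inl c) => .v c
      | .inr (.inr ⟨p, i⟩) => .x i p.natPred, ?_, ?_⟩
  · rintro (_ | c | ⟨p, i⟩)
    · simp
      rfl
    · simp [monomialEval_v, DualBool.pos]
      rfl
    · have h : a' ⟨p, i⟩ = AddMonoidAlgebra.single p (ε i) := by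
        simp [a']
      simp [monomialEval_x, DualBool.pos, h]
      rfl
  · rintro (_ | _ | c | ⟨i, m⟩)
    · exact Or.inl rfl
    · exact Or.inr ⟨.inl (), rfl⟩
    · exact Or.inr ⟨.inr (.inl c), rfl⟩
    · exact Or.inr ⟨.inr (.inr ⟨m.succPNat, i⟩), by simp⟩

theorem monomialEval_mem {A β ι : Type*} [BooleanRing A] (b : β → DualPos V) (ε : ι → A)
    (hε : ∀ i j, i ≠ j → ε i * ε j = 0) (g : Monomial β ι) (hg : g ≠ 0) :
    monomialEval b ε hε g ∈ dualBoolGrading V A g.deg := by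
  rcases g with _ | _ | c | ⟨i, m⟩
  · exact (hg rfl).elim
  · exact DualBool.mem_grading_zero.2 ⟨1, (map_one _).symm⟩
  · exact DualBool.mem_grading_succ.2 ⟨b c, 0, fun h => (h rfl).elim, rfl⟩
  · exact DualBool.mem_grading_succ.2 ⟨0, ε i, fun _ => rfl, rfl⟩

theorem Module.Basis.map_mem_span {R N N' κ : Type*} [CommRing R] [AddCommGroup N] [Module R N]
    [AddCommGroup N'] [Module R N'] (c : Basis κ R N) (L : N →ₗ[R] N') {S : Set N'}
    (hS : ∀ j, L (c j) ∈ S) (a : N) : L a ∈ Submodule.span R S := by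
  have h1 : Submodule.span R (Set.range c) ≤ (Submodule.span R S).comap L := by
    rw [Submodule.span_le]
    rintro _ ⟨j, rfl⟩
    exact Submodule.subset_span (hS j)
  exact h1 (c.mem_span a)

theorem dualBoolGrading_le_span {A β ι : Type*} [BooleanRing A] (b : Basis β (ZMod 2) (DualPos V))
    (ε : Basis ι (ZMod 2) A) (hε : ∀ i j, i ≠ j → ε i * ε j = 0) (d : ℕ) :
    dualBoolGrading V A d ≤
      Submodule.span (ZMod 2) {q | ∃ g : Monomial β ι, g.deg = d ∧ q = monomialEval b ε hε g} := by
  intro z hz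
  rcases d with _ | n
  · obtain ⟨c, rfl⟩ := DualBool.mem_grading_zero.1 hz
    rw [Algebra.algebraMap_eq_smul_one]
    exact Submodule.smul_mem _ c (Submodule.subset_span ⟨1, rfl, (map_one _).symm⟩)
  · obtain ⟨v, a, hv, rfl⟩ := DualBool.mem_grading_succ.1 hz
    rw [← add_zero v, ← zero_add a, ← DualBool.pos_add_pos]
    refine add_mem ?_ ?_
    · by_cases hn : n = 0
      · subst hn
        refine b.map_mem_span (S := _)
          ⟨⟨fun v => DualBool.pos v 1 (0 : A), fun v w => ?_⟩, fun c v => ?_⟩ (fun j => ?_) v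
        · rw [DualBool.pos_add_pos, add_zero]
        · simp [DualBool.smul_pos]
        · exact ⟨.v j, rfl, rfl⟩
      · rw [hv hn, DualBool.pos_zero_zero]
        exact zero_mem _
    · refine ε.map_mem_span (S := _)
        ⟨⟨fun a => DualBool.pos (0 : DualPos V) n.succPNat a, fun v w => ?_⟩, fun c v => ?_⟩
        (fun j => ?_) a
      · rw [DualBool.pos_add_pos, add_zero]
      · simp [DualBool.smul_pos]
      · exact ⟨.x j n, rfl, rfl⟩

end DualBoolBasis

/-! ### Hochschild cohomology of `V_* ⊓ A_*` with coefficients in `V_* ⊓ B_*` -/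

section DualBoolHochschild

open Module

variable {V : Type*} [AddCommGroup V] [Module (ZMod 2) V] {B : Type*} [BooleanRing B]
  (A : Subring B) {β ι : Type*} (b : β → DualPos V) (ε : ι → A)
  (hε : ∀ i j, i ≠ j → ε i * ε j = 0)

theorem monomialEval_v_smul_pos (c : β) (w : DualPos V) (p : ℕ+) (a : B) :
    monomialEval b ε hε (.v c) • DualBool.pos w p a = 0 := by
  rw [DualBool.smul_def, monomialEval_v, DualBool.map_pos, DualBool.pos_mul_pos, map_zero, zero_mul,
    DualBool.pos_zero_zero]

theorem monomialEval_x_smul_pos (i : ι) (m n : ℕ) (w : DualPos V) (a : B) :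
    monomialEval b ε hε (.x i m) • DualBool.pos w n.succPNat a =
      DualBool.pos 0 (n + m + 1).succPNat (ε i * a) := by
  rw [DualBool.smul_def, monomialEval_x, DualBool.map_pos, DualBool.pos_mul_pos]
  congr 1
  rw [← PNat.coe_inj]
  simp only [Nat.succPNat_coe, PNat.add_coe]
  omega

theorem monomialEval_smul_mem (g : Monomial β ι) (d : ℤ) (m : DualBool V B)
    (hm : m ∈ intGrading (dualBoolGrading V B) d) :
    monomialEval b ε hε g • m ∈ intGrading (dualBoolGrading V B) (d + g.deg) := by
  rcases d with (_ | n) | n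
  · obtain ⟨c, rfl⟩ := DualBool.mem_grading_zero.1 hm
    change _ ∈ intGrading _ ((0 : ℤ) + _)
    rw [zero_add]
    have h1 : monomialEval b ε hε g • (algebraMap (ZMod 2) (DualBool V B) c) =
        c • DualBool.map V A.subtype (monomialEval b ε hε g) := by
      rw [DualBool.smul_def, mul_comm, ← Algebra.smul_def]
    rw [h1]
    refine Submodule.smul_mem _ _ ?_
    rcases g with _ | _ | e | ⟨i, m⟩
    · rw [show monomialEval b ε hε .zero = 0 from rfl, map_zero]; exact zero_mem _
    · rw [show monomialEval b ε hε .one = 1 from rfl, map_one]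
      exact DualBool.mem_grading_zero.2 ⟨1, (map_one _).symm⟩
    · rw [monomialEval_v, DualBool.map_pos]
      exact DualBool.mem_grading_succ.2 ⟨_, _, fun h => (h rfl).elim, rfl⟩
    · rw [monomialEval_x, DualBool.map_pos]
      exact DualBool.mem_grading_succ.2 ⟨_, _, fun _ => rfl, rfl⟩
  · rcases g with _ | _ | e | ⟨i, p⟩
    · rw [show monomialEval b ε hε .zero = 0 from rfl, zero_smul]; exact zero_mem _
    · rw [show monomialEval b ε hε .one = 1 from rfl, one_smul]
      simpa [Monomial.deg] using hm
    · obtain ⟨v, a, hv, rfl⟩ := DualBool.mem_grading_succ.1 hm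
      rw [monomialEval_v_smul_pos]
      exact zero_mem _
    · obtain ⟨v, a, hv, rfl⟩ := DualBool.mem_grading_succ.1 hm
      rw [monomialEval_x_smul_pos,
        show Int.ofNat (n + 1) + ((Monomial.x i p : Monomial β ι).deg : ℤ) =
          ((n + p + 1 + 1 : ℕ) : ℤ) by simp [Monomial.deg]; ring]
      exact DualBool.mem_grading_succ.2 ⟨0, _, fun _ => rfl, rfl⟩
  · have h0 : m = 0 := hm
    rw [h0, smul_zero]
    exact zero_mem _

/-- If `c xᵢ + c' y = 0` for scalars `c`, `c'` and a letter `y ≠ xᵢ`, then `c = 0`. -/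
theorem scalar_eq_zero_of_letter {i : ι} (hi : ε i ≠ 0) {y : Monomial β ι}
    (hy : (∃ c, y = .v c) ∨ ∃ k, k ≠ i ∧ y = .x k 0) {m m' : DualBool V B}
    (hm : m ∈ dualBoolGrading V B 0) (hm' : m' ∈ dualBoolGrading V B 0)
    (h : monomialEval b ε hε (.x i 0) • m + monomialEval b ε hε y • m' = 0) : m = 0 := by
  obtain ⟨c, rfl⟩ := DualBool.mem_grading_zero.1 hm
  obtain ⟨c', rfl⟩ := DualBool.mem_grading_zero.1 hm'
  -- Multiplying by `xᵢ` once more kills the second term.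
  have h1 := congrArg (fun z => monomialEval b ε hε (.x i 0) • z) h
  have h2 : monomialEval b ε hε (.x i 0) * monomialEval b ε hε y = 0 := by
    rw [← map_mul]
    rcases hy with ⟨d, rfl⟩ | ⟨k, hk, rfl⟩
    · rw [Monomial.x_mul_v, map_zero]
    · rw [Monomial.x_mul_x hk.symm, map_zero]
  have h3 : monomialEval b ε hε (.x i 0) • monomialEval b ε hε (.x i 0) •
      algebraMap (ZMod 2) (DualBool V B) c =
        DualBool.pos 0 (0 + 0 + 1).succPNat (c • (ε i : B)) := by
    rw [smul_smul, ← map_mul, Monomial.x_mul_x_self, DualBool.smul_def, mul_comm,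
      ← Algebra.smul_def, monomialEval_x, DualBool.map_pos, DualBool.smul_pos, smul_zero]
    rfl
  simp only [smul_add, smul_zero] at h1
  rw [h3, smul_smul _ _ (algebraMap (ZMod 2) (DualBool V B) c'), h2, zero_smul, add_zero,
    ← DualBool.pos_zero_zero] at h1
  have h4 := DualBool.pos_zero_injective _ h1
  have h5 : (ε i : B) ≠ 0 := fun h => hi (Subtype.ext h)
  rcases (smul_eq_zero.1 h4) with h6 | h6
  · rw [h6, map_zero]
  · exact (h5 h6).elim

end DualBoolHochschild

namespace Monomial

variable {β ι : Type*}

/-- At most one letter `xᵢ` cannot be put in front of a nonempty Koszul word. -/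
theorem IsKoszul.exists_forall_ne {w : List (Monomial β ι)} (hw : IsKoszul none w) [Nonempty ι] :
    ∃ h : ι, ∀ i, i ≠ h → IsKoszul (some i) w := by
  rcases w with _ | ⟨_ | _ | c | ⟨k, _ | m⟩, l⟩
  · exact ⟨Classical.arbitrary ι, fun _ _ => trivial⟩
  · exact hw.elim
  · exact hw.elim
  · exact ⟨Classical.arbitrary ι, fun _ _ => hw⟩
  · exact ⟨k, fun i hi => ⟨by simpa using hi, hw.2⟩⟩
  · exact hw.elim

end Monomial

open Monomial in
/-- Vanishing of Hochschild cohomology with values in degree `n + 1 + s`, in all cases in which the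
Koszul complex is exact there: negative degrees, degree zero if there are at least three letters
`xᵢ`, and degrees at least two. -/
theorem subsingleton_HH_dualBool (V : Type*) [AddCommGroup V] [Module (ZMod 2) V]
    (B : Type*) [BooleanRing B] (A : Subring B) [Finite A] (n : ℕ) (s : ℤ)
    (h : n + 1 + s < 0 ∨ (n + 1 + s = 0 ∧ 8 ≤ Nat.card A) ∨ (2 ≤ n + 1 + s ∧ 1 ≤ n)) :
    Subsingleton (HH (dualBoolGrading V A) (intGrading (dualBoolGrading V B)) (n + 1) s) := by
  obtain ⟨r, ε, hε1, hε, hcard⟩ := BooleanRing.exists_basis A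
  let b := Module.Free.chooseBasis (ZMod 2) (DualPos V)
  obtain ⟨bs, γ, hγ, hγ'⟩ := exists_monomialBasis b ε hε
  set e := monomialEval b ε hε
  have hM := monomialEval_smul_mem A b ε hε
  refine subsingleton_HH_of_barD e deg_mul bs γ hγ hγ' _ _ (monomialEval_mem b ε hε)
    (dualBoolGrading_le_span b ε hε) hM n s fun F hF hg hD => ?_
  refine exists_barD_eq e (smul_mem_cochainValues e hM n s)
    (fun k d => cochainValues_succ _ n s k d) (fun k d => cochainValues_of_ne _ _ _ _ _) hF hg hD
    fun G hGp hGg hGD => ?_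
  -- On Koszul words the values lie in degree `n + 1 + s`.
  have hval : ∀ w, IsKoszul none w → w.length = n + 1 →
      G w ∈ intGrading (dualBoolGrading V B) (n + 1 + s) := by
    intro w hw hwn
    have := hGg w
    rw [hw.deg, hwn, mem_cochainValues] at this
    simpa using this
  have trivial_case : (∀ w, IsKoszul none w → w.length = n + 1 → G w = 0) →
      ∃ g : List (Monomial _ _) → DualBool V B, (∀ l, ¬ IsKoszul none l → g l = 0) ∧
        IsGradedBy deg (cochainValues (intGrading (dualBoolGrading V B)) n s) g ∧
        ∀ w, IsKoszul none w → w.length = n + 1 → barD e g w = G w := by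
    intro h0
    refine ⟨0, fun _ _ => rfl, fun _ => zero_mem _, fun w hw hwn => ?_⟩
    rw [h0 w hw hwn, barD_of_isKoszul e (F := 0) (fun _ _ => rfl) (fun _ _ => rfl) hw]
  rcases h with h | ⟨h, hA⟩ | ⟨h, hn⟩
  · refine trivial_case fun w hw hwn => ?_
    have := hval w hw hwn
    obtain ⟨d, hd⟩ := Int.eq_negSucc_of_lt_zero h
    rw [hd] at this
    exact this
  · refine trivial_case fun w hw hwn => ?_
    have hr : 3 ≤ r := by
      by_contra hr
      have : 2 ^ r ≤ 2 ^ 2 := Nat.pow_le_pow_right (by norm_num) (by omega)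
      omega
    have : Nonempty (Fin r) := ⟨⟨0, by omega⟩⟩
    obtain ⟨l, c, rfl⟩ : ∃ l c, w = l ++ [c] :=
      (List.eq_nil_or_concat' w).resolve_left (by rintro rfl; simp at hwn)
    obtain ⟨i₁, hi₁⟩ := hw.exists_forall_ne
    obtain ⟨i₂, hi₂⟩ : ∃ i₂, ∀ i, i ≠ i₂ → (∃ d, c = v d) ∨ ∃ k, k ≠ i ∧ c = x k 0 := by
      rcases isKoszul_letter hw with ⟨d, rfl⟩ | ⟨k, rfl⟩
      · exact ⟨i₁, fun i _ => Or.inl ⟨d, rfl⟩⟩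
      · exact ⟨k, fun i hi => Or.inr ⟨k, hi.symm, rfl⟩⟩
    obtain ⟨i, -, hi⟩ := Finset.exists_mem_notMem_of_card_lt_card
      (s := {i₁, i₂}) (t := (Finset.univ : Finset (Fin r)))
      (Finset.card_le_two.trans_lt (by rw [Finset.card_univ, Fintype.card_fin]; exact hr))
    simp only [Finset.mem_insert, Finset.mem_singleton, not_or] at hi
    have hwi := hi₁ i hi.1
    have h1 := koszul_cocycle e hGp hGD hwi
    have hz : ∀ w, IsKoszul none w → w.length = n + 1 → G w ∈ dualBoolGrading V B 0 := by
      intro w hw hwn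
      have := hval w hw hwn
      rwa [h] at this
    exact scalar_eq_zero_of_letter A b ε hε (ε.ne_zero i) (hi₂ i hi.2) (hz _ hw hwn)
      (hz (x i 0 :: l) ⟨by simp, hwi.of_append⟩ (by simpa using hwn)) h1
  · obtain ⟨j, hj⟩ : ∃ j : ℕ, (n : ℤ) + 1 + s = (j + 1 + 1 : ℕ) :=
      ⟨(n + 1 + s - 2).toNat, by omega⟩
    let u : ℕ → B →+ DualBool V B := fun k =>
      { toFun := fun a => DualBool.pos 0 k.succPNat a
        map_zero' := DualBool.pos_zero_zero _
        map_add' := fun a a' => by rw [DualBool.pos_add_pos, add_zero] }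
    obtain ⟨g, hg1, hg2⟩ := exists_koszul_primitive e (ε := fun i => (ε i : B))
      (u := u j) (u' := u (j + 1)) (u'' := u (j + 1 + 1)) (n := n + 1) (G := G)
      ((map_sum A.subtype (fun i => ε i) _).symm.trans (congrArg A.subtype hε1))
      (fun i k hik => congrArg A.subtype (hε i k hik))
      (fun i a => monomialEval_x_smul_pos A b ε hε i 0 j 0 a)
      (fun i a => monomialEval_x_smul_pos A b ε hε i 0 (j + 1) 0 a)
      (fun c a => monomialEval_v_smul_pos A b ε hε c _ _ a)
      (fun c a => monomialEval_v_smul_pos A b ε hε c _ _ a)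
      (DualBool.pos_zero_injective _) (by omega) hGp hGD (by
        intro w hw hwn
        have := hval w hw hwn
        rw [hj] at this
        obtain ⟨v, a, hv, h1⟩ := DualBool.mem_grading_succ.1 this
        exact ⟨a, by rw [h1, hv (by omega)]; rfl⟩)
    refine ⟨g, fun l hl => (hg1 l).resolve_right fun h => hl h.1, fun l => ?_, hg2⟩
    rcases hg1 l with h1 | ⟨h1, h2, a, h3⟩
    · rw [h1]; exact zero_mem _
    · obtain rfl : l.length = n := by omega
      rw [h1.deg, mem_cochainValues, h3]
      rw [show (l.length : ℤ) + s = (j + 1 : ℕ) by push_cast at hj ⊢; omega]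
      exact DualBool.mem_grading_succ.2 ⟨0, a, fun _ => rfl, rfl⟩

theorem subsingleton_HH_zero {Q M : Type*} [CommRing Q] [Algebra (ZMod 2) Q] [AddCommGroup M]
    [Module (ZMod 2) M] [Module Q M] [IsScalarTower (ZMod 2) Q M]
    (𝒜 : ℕ → Submodule (ZMod 2) Q) (ℳ : ℕ → Submodule (ZMod 2) M) {s : ℤ} (hs : s < 0) :
    Subsingleton (HH 𝒜 (intGrading ℳ) 0 s) := by
  rw [Submodule.Quotient.subsingleton_iff, eq_top_iff]
  rintro ⟨f, hf, -⟩ -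
  rw [Submodule.submoduleOf, Submodule.mem_comap, Submodule.subtype_apply]
  change f = 0
  ext a
  have h1 := hf (fun _ => 0) a fun i => i.elim0
  obtain ⟨d, rfl⟩ := Int.eq_negSucc_of_lt_zero hs
  simpa [intGrading] using h1

end

theorem theorem6p13 (V : Type*) [AddCommGroup V] [Module (ZMod 2) V]
    (B : Type*) [BooleanRing B] (A : Subring B) [Finite A] :
    (∀ k : ℕ, 3 ≤ k →
      Subsingleton (HH (dualBoolGrading V A) (intGrading (dualBoolGrading V B)) k (2 - (k : ℤ)))) ∧
    (8 ≤ Nat.card A → ∀ s : ℤ, s < 0 → ∀ k : ℕ, (k : ℤ) ≠ 1 - s →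
      Subsingleton (HH (dualBoolGrading V A) (intGrading (dualBoolGrading V B)) k s)) := by
  refine ⟨fun k hk => ?_, fun hA s hs k hk => ?_⟩
  · obtain ⟨n, rfl⟩ : ∃ n, k = n + 1 := ⟨k - 1, by omega⟩
    exact subsingleton_HH_dualBool V B A n _ (by push_cast; omega)
  · rcases k with _ | n
    · exact subsingleton_HH_zero _ _ hs
    · exact subsingleton_HH_dualBool V B A n s (by push_cast at hk; omega)
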